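/- Let $\mathbb K=\mathbb R$ or $\mathbb C$ and let $1\le r<\infty$. All spaces $E,E_j,F$ below are Banach spaces over $\mathbb K$, $B_{E^*}$ is the closed unit ball of the dual $E^*$, and for a finite or infinite sequence put $\|(x_i)_i\|_{w,r}=\sup_{\varphi\in B_{E^*}}\big(\sum_i|\varphi(x_i)|^r\big)^{1/r}$. **The ideals.** For integers $1\le n\le r$: * $\Pi_r(E;F)$ is the set of continuous linear $u:E\to F$ for which there is $C\ge 0$ with $\big(\sum_{j=1}^\infty\|u(x_j)\|^r\big)^{1/r}\le C\|(x_j)_{j}\|_{w,r}$ for all weakly $r$-summable sequences $(x_j)_{j=1}^\infty$ in $E$ with $\lim_m\|(x_j)_{j\ge m}\|_{w,r}=0$. * $\mathcal L^n_{d,r}(E_1,\dots,E_n;F)$ is the set of continuous $n$-linear $T:E_1\times\dots\times E_n\to F$ for which there is $C\ge0$ with $\big(\sum_{i=1}^m\|T(x^{(1)}_i,\dots,x^{(n)}_i)\|^{r/n}\big)^{n/r}\le C\prod_{j=1}^n\|(x^{(j)}_i)_{i=1}^m\|_{w,r}$ for all $m$ and all $x^{(j)}_i\in E_j$ ($r$-dominated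 multilinear maps). * $\mathcal P^n_{d,r}({}^nE;F)$ is the set of continuous $n$-homogeneous polynomials $P:E\to F$ for which there is $C\ge0$ with $\big(\sum_{i=1}^m\|P(x_i)\|^{r/n}\big)^{n/r}\le C\|(x_i)_{i=1}^m\|_{w,r}^n$ for all $m$ and all $x_i\in E$ ($r$-dominated polynomials). In each case the norm (written $\|\cdot\|_{as,r}$ for $\Pi_r$ and $\|\cdot\|_{d,r}$ for the other two) is the infimum of the admissible $C$. For a continuous $n$-homogeneous polynomial $P$, $\overset{\vee}{P}$ is the unique symmetric continuous $n$-linear map with $P(x)=\overset{\vee}{P}(x,\dots,x)$, and $P_{a^k}(x)=\overset{\vee}{P}(a,\dots,a,x,\dots,x)$ with $a$ repeated $k$ times, $P_a=P_{a^1}$. **Proposition.** Let $N=\lfloor r\rfloor$ be the largest degree $n$ with $n\le r$. The sequence of pairs $\big((\mathcal P^n_{d,r},\|\cdot\|_{d,r}),(\mathcal L^n_{d,r},\|\cdot\|_{d,r})\big)_{n=1}^{N}$ is strongly coherent and strongly compatible with $\Pi_r$. That is: $\Pi_r$ is a normed operator ideal; for $1\le n\le N$, $\mathcal P^n_{d,r}$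 and $\mathcal L^n_{d,r}$ are (quasi-)normed ideals of $n$-homogeneous polynomials and of $n$-linear maps (linear subspaces containing the maps of finite type, with the ideal property and ideal inequality and with $\|\lambda^n\|=\|\lambda_1\cdots\lambda_n\|=1$ on $\mathbb K$); $\mathcal P^1_{d,r}=\mathcal L^1_{d,r}=\Pi_r$ with equal norms; and there are constants $\alpha_1,\dots,\alpha_4,\beta_1,\dots,\beta_4>0$, independent of the degree and of the spaces, such that the following hold for all Banach spaces. *Strong compatibility*, for every $2\le n\le N$: * (CP1) If $T\in\mathcal L^n_{d,r}(E_1,\dots,E_n;F)$, $1\le k\le n$ and $a_j\in E_j$ ($j\ne k$), then the operator $u(x)=T(a_1,\dots,a_{k-1},x,a_{k+1},\dots,a_n)$ is in $\Pi_r(E_k;F)$ and $\|u\|_{as,r}\le\alpha_1\|T\|_{d,r}\prod_{j\ne k}\|a_j\|$. * (CP2*) If $P\in\mathcal P^n_{d,r}({}^nE;F)$ and $a\in E$, then $P_{a^{n-1}}\in\Pi_r(E;F)$ and $\|P_{a^{n-1}}\|_{as,r}\le\alpha_2\|P\|_{d,r}\|a\|^{n-1}$. * (CP3) If $u\in\Pi_r(E_n;F)$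 and $\gamma_j\in E_j^*$ ($1\le j\le n-1$), then $\gamma_1\cdots\gamma_{n-1}u\in\mathcal L^n_{d,r}(E_1,\dots,E_n;F)$ and $\|\gamma_1\cdots\gamma_{n-1}u\|_{d,r}\le\alpha_3\|\gamma_1\|\cdots\|\gamma_{n-1}\|\,\|u\|_{as,r}$. * (CP4) If $u\in\Pi_r(E;F)$ and $\gamma\in E^*$, then $\gamma^{n-1}u\in\mathcal P^n_{d,r}({}^nE;F)$ and $\|\gamma^{n-1}u\|_{d,r}\le\alpha_4\|\gamma\|^{n-1}\|u\|_{as,r}$. * (CP5) A continuous $n$-homogeneous polynomial $P:E\to F$ is in $\mathcal P^n_{d,r}({}^nE;F)$ if and only if $\overset{\vee}{P}\in\mathcal L^n_{d,r}({}^nE;F)$. *Strong coherence*, for every $k$ with $1\le k\le N-1$: * (CH1) If $T\in\mathcal L^{k+1}_{d,r}(E_1,\dots,E_{k+1};F)$, $1\le j\le k+1$ and $a_j\in E_j$, then the $k$-linear map $T_{a_j}$ obtained by fixing the $j$-th variable at $a_j$ is in $\mathcal L^k_{d,r}$ and $\|T_{a_j}\|_{d,r}\le\beta_1\|T\|_{d,r}\|a_j\|$.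 * (CH2*) If $P\in\mathcal P^{k+1}_{d,r}({}^{k+1}E;F)$ and $a\in E$, then $P_a\in\mathcal P^k_{d,r}({}^kE;F)$ and $\|P_a\|_{d,r}\le\beta_2\|P\|_{d,r}\|a\|$. * (CH3) If $T\in\mathcal L^k_{d,r}(E_1,\dots,E_k;F)$ and $\gamma\in E_{k+1}^*$, then $\gamma T\in\mathcal L^{k+1}_{d,r}(E_1,\dots,E_{k+1};F)$ and $\|\gamma T\|_{d,r}\le\beta_3\|\gamma\|\,\|T\|_{d,r}$. * (CH4) If $P\in\mathcal P^k_{d,r}({}^kE;F)$ and $\gamma\in E^*$, then $\gamma P\in\mathcal P^{k+1}_{d,r}({}^{k+1}E;F)$ and $\|\gamma P\|_{d,r}\le\beta_4\|\gamma\|\,\|P\|_{d,r}$. * (CH5) For every $1\le k\le N$, a continuous $k$-homogeneous polynomial $P:E\to F$ is in $\mathcal P^k_{d,r}({}^kE;F)$ if and only if $\overset{\vee}{P}\in\mathcal L^k_{d,r}({}^kE;F)$. -/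

import Mathlib

open scoped NNReal ENNReal
open Filter Topology

universe u w

namespace DominatedIdeals

noncomputable section

/-! ## Continuous homogeneous polynomials -/

section Polynomials

variable (𝕜 : Type w) [RCLike 𝕜]

/-- The space of continuous `n`-homogeneous polynomials from `E` to `F`: the maps of the form
`x ↦ T (x, …, x)` with `T` a continuous `n`-linear map. -/
def HomPoly (n : ℕ) (E : Type u) [NormedAddCommGroup E] [NormedSpace 𝕜 E]
    (F : Type u) [NormedAddCommGroup F] [NormedSpace 𝕜 F] : Submodule 𝕜 (E → F) where
  carrier := {P | ∃ T : ContinuousMultilinearMap 𝕜 (fun _ : Fin n => E) F,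
    ∀ x, P x = T fun _ => x}
  add_mem' := by
    rintro P Q ⟨S, hS⟩ ⟨T, hT⟩
    exact ⟨S + T, fun x => by simp [hS, hT]⟩
  zero_mem' := ⟨0, fun x => by simp⟩
  smul_mem' := by
    rintro c P ⟨T, hT⟩
    exact ⟨c • T, fun x => by simp [hT]⟩

variable {𝕜}
variable {n : ℕ} {E F G H : Type u}
  [NormedAddCommGroup E] [NormedSpace 𝕜 E] [NormedAddCommGroup F] [NormedSpace 𝕜 F]
  [NormedAddCommGroup G] [NormedSpace 𝕜 G] [NormedAddCommGroup H] [NormedSpace 𝕜 H]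

/-- Symmetry of a continuous `n`-linear map. -/
def IsSymmetric (T : ContinuousMultilinearMap 𝕜 (fun _ : Fin n => E) F) : Prop :=
  ∀ (σ : Equiv.Perm (Fin n)) (x : Fin n → E), (T fun i => x (σ i)) = T x

/-- A continuous `n`-homogeneous polynomial is induced by exactly one symmetric continuous
`n`-linear map. -/
theorem existsUnique_symmetric (P : HomPoly 𝕜 n E F) :
    ∃! T : ContinuousMultilinearMap 𝕜 (fun _ : Fin n => E) F,
      IsSymmetric T ∧ ∀ x, P.1 x = T fun _ => x := by
  have hfac : ((n.factorial : ℕ) : 𝕜) ≠ 0 := by exact_mod_cast n.factorial_ne_zero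
  obtain ⟨A, hA⟩ := P.2
  set S : ContinuousMultilinearMap 𝕜 (fun _ : Fin n => E) F :=
    ((n.factorial : ℕ) : 𝕜)⁻¹ • ∑ σ : Equiv.Perm (Fin n), A.domDomCongr σ with hSdef
  have hS : ∀ x, S x = ((n.factorial : ℕ) : 𝕜)⁻¹ •
      ∑ σ : Equiv.Perm (Fin n), A fun i => x (σ i) := fun x => by simp [hSdef]
  have hSs : IsSymmetric S := by
    intro τ x
    rw [hS, hS]
    congr 1
    exact Fintype.sum_equiv (Equiv.mulLeft τ) _ _ (fun σ => rfl)
  have hSd : ∀ x, P.1 x = S fun _ => x := by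
    intro x
    rw [hS, Finset.sum_const, Finset.card_univ, Fintype.card_perm, Fintype.card_fin,
      ← Nat.cast_smul_eq_nsmul 𝕜, smul_smul, inv_mul_cancel₀ hfac, one_smul, hA]
  have key : ∀ T : ContinuousMultilinearMap 𝕜 (fun _ : Fin n => E) F, IsSymmetric T →
      (∀ x, P.1 x = T fun _ => x) → ∀ v : Fin n → E,
      iteratedFDeriv 𝕜 n P.1 0 v = ((n.factorial : ℕ) : 𝕜) • T v := by
    intro T hs hd v
    have h := T.iteratedFDeriv_comp_diagonal 0 v
    rw [← funext hd] at h
    rw [h, Finset.sum_congr rfl (fun σ _ => hs σ v)]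
    simp [Finset.card_univ, Fintype.card_perm, Nat.cast_smul_eq_nsmul]
  refine ⟨S, ⟨hSs, hSd⟩, fun T hT => ?_⟩
  ext v
  exact smul_right_injective F hfac ((key T hT.1 hT.2 v).symm.trans (key S hSs hSd v))

/-- `P^∨`, the unique symmetric continuous `n`-linear map with `P^∨ (x, …, x) = P x`. -/
def polar (P : HomPoly 𝕜 n E F) : ContinuousMultilinearMap 𝕜 (fun _ : Fin n => E) F :=
  (existsUnique_symmetric P).choose

theorem polar_isSymmetric (P : HomPoly 𝕜 n E F) : IsSymmetric (polar P) :=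
  (existsUnique_symmetric P).choose_spec.1.1

theorem polar_diag (P : HomPoly 𝕜 n E F) (x : E) : P.1 x = polar P fun _ => x :=
  (existsUnique_symmetric P).choose_spec.1.2 x

theorem eq_polar (P : HomPoly 𝕜 n E F)
    {T : ContinuousMultilinearMap 𝕜 (fun _ : Fin n => E) F} (hs : IsSymmetric T)
    (hd : ∀ x, P.1 x = T fun _ => x) : T = polar P :=
  (existsUnique_symmetric P).choose_spec.2 T ⟨hs, hd⟩

/-- `P_a (x) = P^∨ (a, x, …, x)`. -/
def polyAt (P : HomPoly 𝕜 (n + 1) E F) (a : E) : HomPoly 𝕜 n E F :=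
  ⟨fun x => polar P (Fin.cons a fun _ => x),
    ⟨(polar P).curryLeft a, fun _ => rfl⟩⟩

/-- For `P` of degree `n = m + 1`, the linear operator `P_{a^{n-1}} (x) = P^∨ (a, …, a, x)`. -/
def polyAtLinear {m : ℕ} (P : HomPoly 𝕜 (m + 1) E F) (a : E) : E →L[𝕜] F :=
  (polar P).toContinuousLinearMap (fun _ => a) (Fin.last m)

/-- `w ∘ P ∘ v`. -/
def polyComp (w : F →L[𝕜] H) (P : HomPoly 𝕜 n E F) (v : G →L[𝕜] E) : HomPoly 𝕜 n G H :=
  ⟨fun x => w (P.1 (v x)), by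
    obtain ⟨T, hT⟩ := P.2
    exact ⟨w.compContinuousMultilinearMap (T.compContinuousLinearMap fun _ => v),
      fun x => by simp [hT]⟩⟩

/-- `γ P : x ↦ γ (x) P (x)`. -/
def functionalMulPoly (γ : E →L[𝕜] 𝕜) (P : HomPoly 𝕜 n E F) : HomPoly 𝕜 (n + 1) E F :=
  ⟨fun x => γ x • P.1 x,
    ⟨ContinuousMultilinearMap.uncurryRight
      ((ContinuousLinearMap.smulRightL 𝕜 E F γ).compContinuousMultilinearMap (polar P)),
      fun x => congrArg (fun y => γ x • y) (polar_diag P x)⟩⟩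

/-- `γ₁ ⋯ γ_m u : (x₁, …, x_{m+1}) ↦ γ₁ (x₁) ⋯ γ_m (x_m) u (x_{m+1})`. -/
def functionalsMulLinear {m : ℕ} {E : Fin (m + 1) → Type u}
    [∀ i, NormedAddCommGroup (E i)] [∀ i, NormedSpace 𝕜 (E i)]
    (γ : ∀ i : Fin m, E i.castSucc →L[𝕜] 𝕜) (u : E (Fin.last m) →L[𝕜] F) :
    ContinuousMultilinearMap 𝕜 E F :=
  ContinuousMultilinearMap.uncurryRight
    (((ContinuousMultilinearMap.mkPiAlgebra 𝕜 (Fin m) 𝕜).compContinuousLinearMap γ).smulRight u)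

theorem functionalsMulLinear_apply {m : ℕ} {E : Fin (m + 1) → Type u}
    [∀ i, NormedAddCommGroup (E i)] [∀ i, NormedSpace 𝕜 (E i)]
    (γ : ∀ i : Fin m, E i.castSucc →L[𝕜] 𝕜) (u : E (Fin.last m) →L[𝕜] F) (x : ∀ i, E i) :
    functionalsMulLinear γ u x = (∏ i : Fin m, γ i (x i.castSucc)) • u (x (Fin.last m)) := by
  simp [functionalsMulLinear, Fin.init]

/-- `γ^m u : x ↦ γ (x)^m u (x)`, a polynomial of degree `m + 1`. -/
def functionalPowMulLinear (m : ℕ) (γ : E →L[𝕜] 𝕜) (u : E →L[𝕜] F) : HomPoly 𝕜 (m + 1) E F :=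
  ⟨fun x => (γ x) ^ m • u x,
    ⟨functionalsMulLinear (fun _ => γ) u, fun x => by simp [functionalsMulLinear_apply]⟩⟩

/-- `γ T : (x₁, …, x_{k+1}) ↦ γ (x_{k+1}) T (x₁, …, x_k)`. -/
def functionalMulMulti {k : ℕ} {E : Fin (k + 1) → Type u}
    [∀ i, NormedAddCommGroup (E i)] [∀ i, NormedSpace 𝕜 (E i)]
    (γ : E (Fin.last k) →L[𝕜] 𝕜)
    (T : ContinuousMultilinearMap 𝕜 (fun i : Fin k => E i.castSucc) F) :
    ContinuousMultilinearMap 𝕜 E F :=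
  ContinuousMultilinearMap.uncurryRight
    ((ContinuousLinearMap.smulRightL 𝕜 (E (Fin.last k)) F γ).compContinuousMultilinearMap T)

theorem functionalMulMulti_apply {k : ℕ} {E : Fin (k + 1) → Type u}
    [∀ i, NormedAddCommGroup (E i)] [∀ i, NormedSpace 𝕜 (E i)]
    (γ : E (Fin.last k) →L[𝕜] 𝕜)
    (T : ContinuousMultilinearMap 𝕜 (fun i : Fin k => E i.castSucc) F) (x : ∀ i, E i) :
    functionalMulMulti γ T x = γ (x (Fin.last k)) • T fun i => x i.castSucc := rfl

end Polynomials

/-! ## Classes of operators, polynomials and multilinear maps between Banach spaces -/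

/-- A class of continuous linear operators between Banach spaces, with a size function. -/
structure OperatorClass (𝕜 : Type w) [RCLike 𝕜] where
  mem : ∀ {E F : Type u} [NormedAddCommGroup E] [NormedSpace 𝕜 E] [CompleteSpace E]
    [NormedAddCommGroup F] [NormedSpace 𝕜 F] [CompleteSpace F], (E →L[𝕜] F) → Prop
  nrm : ∀ {E F : Type u} [NormedAddCommGroup E] [NormedSpace 𝕜 E] [CompleteSpace E]
    [NormedAddCommGroup F] [NormedSpace 𝕜 F] [CompleteSpace F], (E →L[𝕜] F) → ℝ

/-- A class of continuous homogeneous polynomials between Banach spaces, with a size function. -/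
structure PolyClass (𝕜 : Type w) [RCLike 𝕜] where
  mem : ∀ {n : ℕ} {E F : Type u} [NormedAddCommGroup E] [NormedSpace 𝕜 E] [CompleteSpace E]
    [NormedAddCommGroup F] [NormedSpace 𝕜 F] [CompleteSpace F], HomPoly 𝕜 n E F → Prop
  nrm : ∀ {n : ℕ} {E F : Type u} [NormedAddCommGroup E] [NormedSpace 𝕜 E] [CompleteSpace E]
    [NormedAddCommGroup F] [NormedSpace 𝕜 F] [CompleteSpace F], HomPoly 𝕜 n E F → ℝ

/-- A class of continuous multilinear maps between Banach spaces, with a size function. -/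
structure MultiClass (𝕜 : Type w) [RCLike 𝕜] where
  mem : ∀ {n : ℕ} {E : Fin n → Type u} {F : Type u}
    [∀ i, NormedAddCommGroup (E i)] [∀ i, NormedSpace 𝕜 (E i)] [∀ i, CompleteSpace (E i)]
    [NormedAddCommGroup F] [NormedSpace 𝕜 F] [CompleteSpace F],
    ContinuousMultilinearMap 𝕜 E F → Prop
  nrm : ∀ {n : ℕ} {E : Fin n → Type u} {F : Type u}
    [∀ i, NormedAddCommGroup (E i)] [∀ i, NormedSpace 𝕜 (E i)] [∀ i, CompleteSpace (E i)]
    [NormedAddCommGroup F] [NormedSpace 𝕜 F] [CompleteSpace F],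
    ContinuousMultilinearMap 𝕜 E F → ℝ

/-- `mem` is a linear subspace of `V`, on which `nrm` is a quasi-norm with constant `K`
(a norm if `K = 1`). -/
structure IsQuasiNormedSubspace (𝕜 : Type w) [RCLike 𝕜] {V : Type*} [AddCommGroup V] [Module 𝕜 V]
    (mem : V → Prop) (nrm : V → ℝ) (K : ℝ) : Prop where
  zero_mem : mem 0
  add_mem : ∀ x y, mem x → mem y → mem (x + y)
  smul_mem : ∀ (c : 𝕜) x, mem x → mem (c • x)
  nonneg : ∀ x, mem x → 0 ≤ nrm x
  eq_zero_iff : ∀ x, mem x → (nrm x = 0 ↔ x = 0)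
  nrm_smul : ∀ (c : 𝕜) x, mem x → nrm (c • x) = ‖c‖ * nrm x
  nrm_add_le : ∀ x y, mem x → mem y → nrm (x + y) ≤ K * (nrm x + nrm y)

/-- Normed operator ideals. In the normalisation condition `L` is the scalar field, seen as a
Banach space of the universe under consideration through `e`. -/
structure IsNormedOperatorIdeal {𝕜 : Type w} [RCLike 𝕜] (U : OperatorClass.{u, w} 𝕜) : Prop where
  normed : ∀ (E F : Type u) [NormedAddCommGroup E] [NormedSpace 𝕜 E] [CompleteSpace E]
    [NormedAddCommGroup F] [NormedSpace 𝕜 F] [CompleteSpace F],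
    IsQuasiNormedSubspace 𝕜 (fun v : E →L[𝕜] F => U.mem v) (fun v => U.nrm v) 1
  finiteRank : ∀ {E F : Type u} [NormedAddCommGroup E] [NormedSpace 𝕜 E] [CompleteSpace E]
    [NormedAddCommGroup F] [NormedSpace 𝕜 F] [CompleteSpace F] (v : E →L[𝕜] F),
    FiniteDimensional 𝕜 (LinearMap.range (v : E →ₗ[𝕜] F)) → U.mem v
  normalised : ∀ {L : Type u} [NormedAddCommGroup L] [NormedSpace 𝕜 L] [CompleteSpace L],
    (L ≃ₗᵢ[𝕜] 𝕜) → U.nrm (ContinuousLinearMap.id 𝕜 L) = 1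
  comp : ∀ {E F G H : Type u} [NormedAddCommGroup E] [NormedSpace 𝕜 E] [CompleteSpace E]
    [NormedAddCommGroup F] [NormedSpace 𝕜 F] [CompleteSpace F]
    [NormedAddCommGroup G] [NormedSpace 𝕜 G] [CompleteSpace G]
    [NormedAddCommGroup H] [NormedSpace 𝕜 H] [CompleteSpace H]
    (w : F →L[𝕜] H) (v : E →L[𝕜] F) (t : G →L[𝕜] E), U.mem v →
    U.mem (w ∘L v ∘L t) ∧ U.nrm (w ∘L v ∘L t) ≤ ‖w‖ * U.nrm v * ‖t‖

/-- The degree `n` component of `Q` is a quasi-normed ideal of `n`-homogeneous polynomials. -/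
structure IsQuasiNormedPolyIdeal {𝕜 : Type w} [RCLike 𝕜] (n : ℕ) (Q : PolyClass.{u, w} 𝕜) :
    Prop where
  quasiNormed : ∀ (E F : Type u) [NormedAddCommGroup E] [NormedSpace 𝕜 E] [CompleteSpace E]
    [NormedAddCommGroup F] [NormedSpace 𝕜 F] [CompleteSpace F],
    ∃ K : ℝ, IsQuasiNormedSubspace 𝕜 (fun P : HomPoly 𝕜 n E F => Q.mem P) (fun P => Q.nrm P) K
  finiteType : ∀ {E F : Type u} [NormedAddCommGroup E] [NormedSpace 𝕜 E] [CompleteSpace E]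
    [NormedAddCommGroup F] [NormedSpace 𝕜 F] [CompleteSpace F] (P : HomPoly 𝕜 n E F),
    P ∈ Submodule.span 𝕜 {R : HomPoly 𝕜 n E F |
      ∃ (γ : E →L[𝕜] 𝕜) (b : F), ∀ x, R.1 x = (γ x) ^ n • b} → Q.mem P
  normalised : ∀ {L : Type u} [NormedAddCommGroup L] [NormedSpace 𝕜 L] [CompleteSpace L]
    (e : L ≃ₗᵢ[𝕜] 𝕜) (P : HomPoly 𝕜 n L L), (∀ x, P.1 x = e.symm ((e x) ^ n)) → Q.nrm P = 1
  comp : ∀ {E F G H : Type u} [NormedAddCommGroup E] [NormedSpace 𝕜 E] [CompleteSpace E]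
    [NormedAddCommGroup F] [NormedSpace 𝕜 F] [CompleteSpace F]
    [NormedAddCommGroup G] [NormedSpace 𝕜 G] [CompleteSpace G]
    [NormedAddCommGroup H] [NormedSpace 𝕜 H] [CompleteSpace H]
    (w : F →L[𝕜] H) (P : HomPoly 𝕜 n E F) (t : G →L[𝕜] E), Q.mem P →
    Q.mem (polyComp w P t) ∧ Q.nrm (polyComp w P t) ≤ ‖w‖ * Q.nrm P * ‖t‖ ^ n

/-- The degree `n` component of `M` is a quasi-normed ideal of `n`-linear mappings. -/
structure IsQuasiNormedMultiIdeal {𝕜 : Type w} [RCLike 𝕜] (n : ℕ) (M : MultiClass.{u, w} 𝕜) :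
    Prop where
  quasiNormed : ∀ (E : Fin n → Type u) (F : Type u)
    [∀ i, NormedAddCommGroup (E i)] [∀ i, NormedSpace 𝕜 (E i)] [∀ i, CompleteSpace (E i)]
    [NormedAddCommGroup F] [NormedSpace 𝕜 F] [CompleteSpace F],
    ∃ K : ℝ, IsQuasiNormedSubspace 𝕜 (fun T : ContinuousMultilinearMap 𝕜 E F => M.mem T)
      (fun T => M.nrm T) K
  finiteType : ∀ {E : Fin n → Type u} {F : Type u}
    [∀ i, NormedAddCommGroup (E i)] [∀ i, NormedSpace 𝕜 (E i)] [∀ i, CompleteSpace (E i)]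
    [NormedAddCommGroup F] [NormedSpace 𝕜 F] [CompleteSpace F]
    (T : ContinuousMultilinearMap 𝕜 E F),
    T ∈ Submodule.span 𝕜 {S : ContinuousMultilinearMap 𝕜 E F |
      ∃ (γ : ∀ i, E i →L[𝕜] 𝕜) (b : F), ∀ x, S x = (∏ i, γ i (x i)) • b} → M.mem T
  normalised : ∀ {L : Type u} [NormedAddCommGroup L] [NormedSpace 𝕜 L] [CompleteSpace L]
    (e : L ≃ₗᵢ[𝕜] 𝕜) (T : ContinuousMultilinearMap 𝕜 (fun _ : Fin n => L) L),
    (∀ x, T x = e.symm (∏ i, e (x i))) → M.nrm T = 1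
  comp : ∀ {E G : Fin n → Type u} {F H : Type u}
    [∀ i, NormedAddCommGroup (E i)] [∀ i, NormedSpace 𝕜 (E i)] [∀ i, CompleteSpace (E i)]
    [∀ i, NormedAddCommGroup (G i)] [∀ i, NormedSpace 𝕜 (G i)] [∀ i, CompleteSpace (G i)]
    [NormedAddCommGroup F] [NormedSpace 𝕜 F] [CompleteSpace F]
    [NormedAddCommGroup H] [NormedSpace 𝕜 H] [CompleteSpace H]
    (w : F →L[𝕜] H) (T : ContinuousMultilinearMap 𝕜 E F) (t : ∀ i, G i →L[𝕜] E i), M.mem T →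
    M.mem (w.compContinuousMultilinearMap (T.compContinuousLinearMap t)) ∧
    M.nrm (w.compContinuousMultilinearMap (T.compContinuousLinearMap t)) ≤
      ‖w‖ * M.nrm T * ∏ i, ‖t i‖

/-- `(U_k, M_k)_{k=1}^N` is a sequence of pairs of quasi-normed ideals of `k`-homogeneous
polynomials (the components of `Q`) and of `k`-linear mappings (the components of `M`), `U` is a
normed operator ideal, and `U_1 = M_1 = U`, with equal norms. -/
structure IsPairSequence {𝕜 : Type w} [RCLike 𝕜] (N : ℕ∞) (U : OperatorClass.{u, w} 𝕜)
    (Q : PolyClass.{u, w} 𝕜) (M : MultiClass.{u, w} 𝕜) : Prop where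
  operatorIdeal : IsNormedOperatorIdeal U
  polyIdeal : ∀ k : ℕ, 1 ≤ k → (k : ℕ∞) ≤ N → IsQuasiNormedPolyIdeal k Q
  multiIdeal : ∀ k : ℕ, 1 ≤ k → (k : ℕ∞) ≤ N → IsQuasiNormedMultiIdeal k M
  poly_one : ∀ {E F : Type u} [NormedAddCommGroup E] [NormedSpace 𝕜 E] [CompleteSpace E]
    [NormedAddCommGroup F] [NormedSpace 𝕜 F] [CompleteSpace F]
    (v : E →L[𝕜] F) (P : HomPoly 𝕜 1 E F), (∀ x, P.1 x = v x) →
    (Q.mem P ↔ U.mem v) ∧ (U.mem v → Q.nrm P = U.nrm v)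
  multi_one : ∀ {E : Fin 1 → Type u} {F : Type u}
    [∀ i, NormedAddCommGroup (E i)] [∀ i, NormedSpace 𝕜 (E i)] [∀ i, CompleteSpace (E i)]
    [NormedAddCommGroup F] [NormedSpace 𝕜 F] [CompleteSpace F]
    (v : E 0 →L[𝕜] F) (T : ContinuousMultilinearMap 𝕜 E F), (∀ x, T x = v (x 0)) →
    (M.mem T ↔ U.mem v) ∧ (U.mem v → M.nrm T = U.nrm v)

/-- Strong compatibility of `(U_n, M_n)_{n=1}^N` with `U`. The degree is written `n = m + 1`;
the constants depend neither on the degree nor on the spaces. -/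
def StronglyCompatible {𝕜 : Type w} [RCLike 𝕜] (N : ℕ∞) (U : OperatorClass.{u, w} 𝕜)
    (Q : PolyClass.{u, w} 𝕜) (M : MultiClass.{u, w} 𝕜) : Prop :=
  IsPairSequence N U Q M ∧
  ∃ α₁ α₂ α₃ α₄ : ℝ, 0 < α₁ ∧ 0 < α₂ ∧ 0 < α₃ ∧ 0 < α₄ ∧
  ∀ m : ℕ, 1 ≤ m → ((m + 1 : ℕ) : ℕ∞) ≤ N →
    -- (CP1)
    (∀ {E : Fin (m + 1) → Type u} {F : Type u}
      [∀ i, NormedAddCommGroup (E i)] [∀ i, NormedSpace 𝕜 (E i)] [∀ i, CompleteSpace (E i)]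
      [NormedAddCommGroup F] [NormedSpace 𝕜 F] [CompleteSpace F]
      (k : Fin (m + 1)) (T : ContinuousMultilinearMap 𝕜 E F) (a : ∀ i, E i), M.mem T →
      U.mem (T.toContinuousLinearMap a k) ∧
      U.nrm (T.toContinuousLinearMap a k) ≤
        α₁ * M.nrm T * ∏ j ∈ Finset.univ.erase k, ‖a j‖) ∧
    -- (CP2*)
    (∀ {E F : Type u} [NormedAddCommGroup E] [NormedSpace 𝕜 E] [CompleteSpace E]
      [NormedAddCommGroup F] [NormedSpace 𝕜 F] [CompleteSpace F]
      (P : HomPoly 𝕜 (m + 1) E F) (a : E), Q.mem P →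
      U.mem (polyAtLinear P a) ∧ U.nrm (polyAtLinear P a) ≤ α₂ * Q.nrm P * ‖a‖ ^ m) ∧
    -- (CP3)
    (∀ {E : Fin (m + 1) → Type u} {F : Type u}
      [∀ i, NormedAddCommGroup (E i)] [∀ i, NormedSpace 𝕜 (E i)] [∀ i, CompleteSpace (E i)]
      [NormedAddCommGroup F] [NormedSpace 𝕜 F] [CompleteSpace F]
      (γ : ∀ i : Fin m, E i.castSucc →L[𝕜] 𝕜) (v : E (Fin.last m) →L[𝕜] F), U.mem v →
      M.mem (functionalsMulLinear γ v) ∧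
      M.nrm (functionalsMulLinear γ v) ≤ α₃ * (∏ i, ‖γ i‖) * U.nrm v) ∧
    -- (CP4)
    (∀ {E F : Type u} [NormedAddCommGroup E] [NormedSpace 𝕜 E] [CompleteSpace E]
      [NormedAddCommGroup F] [NormedSpace 𝕜 F] [CompleteSpace F]
      (γ : E →L[𝕜] 𝕜) (v : E →L[𝕜] F), U.mem v →
      Q.mem (functionalPowMulLinear m γ v) ∧
      Q.nrm (functionalPowMulLinear m γ v) ≤ α₄ * ‖γ‖ ^ m * U.nrm v) ∧
    -- (CP5)
    (∀ {E F : Type u} [NormedAddCommGroup E] [NormedSpace 𝕜 E] [CompleteSpace E]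
      [NormedAddCommGroup F] [NormedSpace 𝕜 F] [CompleteSpace F]
      (P : HomPoly 𝕜 (m + 1) E F), Q.mem P ↔ M.mem (polar P))

/-- Strong coherence of `(U_k, M_k)_{k=1}^N`; the constants depend neither on the degree nor on
the spaces. -/
def StronglyCoherent {𝕜 : Type w} [RCLike 𝕜] (N : ℕ∞) (U : OperatorClass.{u, w} 𝕜)
    (Q : PolyClass.{u, w} 𝕜) (M : MultiClass.{u, w} 𝕜) : Prop :=
  IsPairSequence N U Q M ∧
  (∃ β₁ β₂ β₃ β₄ : ℝ, 0 < β₁ ∧ 0 < β₂ ∧ 0 < β₃ ∧ 0 < β₄ ∧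
  ∀ k : ℕ, 1 ≤ k → ((k + 1 : ℕ) : ℕ∞) ≤ N →
    -- (CH1)
    (∀ {E : Fin (k + 1) → Type u} {F : Type u}
      [∀ i, NormedAddCommGroup (E i)] [∀ i, NormedSpace 𝕜 (E i)] [∀ i, CompleteSpace (E i)]
      [NormedAddCommGroup F] [NormedSpace 𝕜 F] [CompleteSpace F]
      (T : ContinuousMultilinearMap 𝕜 E F) (j : Fin (k + 1)) (a : E j), M.mem T →
      M.mem (T.curryMid j a) ∧ M.nrm (T.curryMid j a) ≤ β₁ * M.nrm T * ‖a‖) ∧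
    -- (CH2*)
    (∀ {E F : Type u} [NormedAddCommGroup E] [NormedSpace 𝕜 E] [CompleteSpace E]
      [NormedAddCommGroup F] [NormedSpace 𝕜 F] [CompleteSpace F]
      (P : HomPoly 𝕜 (k + 1) E F) (a : E), Q.mem P →
      Q.mem (polyAt P a) ∧ Q.nrm (polyAt P a) ≤ β₂ * Q.nrm P * ‖a‖) ∧
    -- (CH3)
    (∀ {E : Fin (k + 1) → Type u} {F : Type u}
      [∀ i, NormedAddCommGroup (E i)] [∀ i, NormedSpace 𝕜 (E i)] [∀ i, CompleteSpace (E i)]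
      [NormedAddCommGroup F] [NormedSpace 𝕜 F] [CompleteSpace F]
      (γ : E (Fin.last k) →L[𝕜] 𝕜)
      (T : ContinuousMultilinearMap 𝕜 (fun i : Fin k => E i.castSucc) F), M.mem T →
      M.mem (functionalMulMulti γ T) ∧
      M.nrm (functionalMulMulti γ T) ≤ β₃ * ‖γ‖ * M.nrm T) ∧
    -- (CH4)
    (∀ {E F : Type u} [NormedAddCommGroup E] [NormedSpace 𝕜 E] [CompleteSpace E]
      [NormedAddCommGroup F] [NormedSpace 𝕜 F] [CompleteSpace F]
      (γ : E →L[𝕜] 𝕜) (P : HomPoly 𝕜 k E F), Q.mem P →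
      Q.mem (functionalMulPoly γ P) ∧
      Q.nrm (functionalMulPoly γ P) ≤ β₄ * ‖γ‖ * Q.nrm P)) ∧
  -- (CH5)
  ∀ k : ℕ, 1 ≤ k → (k : ℕ∞) ≤ N →
    ∀ {E F : Type u} [NormedAddCommGroup E] [NormedSpace 𝕜 E] [CompleteSpace E]
      [NormedAddCommGroup F] [NormedSpace 𝕜 F] [CompleteSpace F]
      (P : HomPoly 𝕜 k E F), Q.mem P ↔ M.mem (polar P)

/-! ## Absolutely summing operators, dominated polynomials and multilinear maps -/

section Summing

variable (𝕜 : Type w) [RCLike 𝕜]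

/-- `‖(x_i)_i‖_{w,r} = sup_{φ ∈ B_{E^*}} (∑_i |φ (x_i)|^r)^{1/r}`, for a finite or infinite
family. -/
def weakNorm (r : ℝ) {ι : Type*} {E : Type u} [NormedAddCommGroup E] [NormedSpace 𝕜 E]
    (x : ι → E) : ℝ≥0∞ :=
  ⨆ (φ : E →L[𝕜] 𝕜) (_ : ‖φ‖ ≤ 1), (∑' i, ‖φ (x i)‖ₑ ^ r) ^ (1 / r)

/-- The space `ℓ_r^u (E)` of unconditionally `r`-summable sequences: the weakly `r`-summable
sequences whose tails tend to zero in the weak `r`-norm. -/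
def lru (r : ℝ) (E : Type u) [NormedAddCommGroup E] [NormedSpace 𝕜 E] : Set (ℕ → E) :=
  {x | (∀ φ : E →L[𝕜] 𝕜, Summable fun j => ‖φ (x j)‖ ^ r) ∧
    Tendsto (fun m => weakNorm 𝕜 r fun j => x (j + m)) atTop (𝓝 0)}

variable {𝕜}

/-- `C` is a constant in the definition of absolutely `r`-summing operators. -/
def SummingBound (r : ℝ) {E F : Type u} [NormedAddCommGroup E] [NormedSpace 𝕜 E]
    [NormedAddCommGroup F] [NormedSpace 𝕜 F] (v : E →L[𝕜] F) (C : ℝ≥0) : Prop :=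
  ∀ x ∈ lru 𝕜 r E, (∑' j, ‖v (x j)‖ₑ ^ r) ^ (1 / r) ≤ C * weakNorm 𝕜 r x

/-- `C` is a constant in the definition of `r`-dominated `n`-homogeneous polynomials. -/
def PolyDominatedBound (r : ℝ) {n : ℕ} {E F : Type u} [NormedAddCommGroup E] [NormedSpace 𝕜 E]
    [NormedAddCommGroup F] [NormedSpace 𝕜 F] (P : HomPoly 𝕜 n E F) (C : ℝ≥0) : Prop :=
  ∀ (m : ℕ) (x : Fin m → E),
    (∑ i, ‖P.1 (x i)‖ₑ ^ (r / n)) ^ ((n : ℝ) / r) ≤ C * weakNorm 𝕜 r x ^ n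

/-- `C` is a constant in the definition of `r`-dominated `n`-linear maps; `x j` is the finite
sequence taken in the `j`-th space. -/
def MultiDominatedBound (r : ℝ) {n : ℕ} {E : Fin n → Type u} {F : Type u}
    [∀ i, NormedAddCommGroup (E i)] [∀ i, NormedSpace 𝕜 (E i)]
    [NormedAddCommGroup F] [NormedSpace 𝕜 F]
    (T : ContinuousMultilinearMap 𝕜 E F) (C : ℝ≥0) : Prop :=
  ∀ (m : ℕ) (x : ∀ j, Fin m → E j),
    (∑ i, ‖T fun j => x j i‖ₑ ^ (r / n)) ^ ((n : ℝ) / r) ≤ C * ∏ j, weakNorm 𝕜 r (x j)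

variable (𝕜)

/-- The ideal `Π_r` of absolutely `r`-summing operators. -/
def summingIdeal (r : ℝ) : OperatorClass.{u, w} 𝕜 where
  mem v := ∃ C : ℝ≥0, SummingBound r v C
  nrm v := ((sInf {C : ℝ≥0 | SummingBound r v C} : ℝ≥0) : ℝ)

/-- The `r`-dominated polynomials. -/
def dominatedPoly (r : ℝ) : PolyClass.{u, w} 𝕜 where
  mem P := ∃ C : ℝ≥0, PolyDominatedBound r P C
  nrm P := ((sInf {C : ℝ≥0 | PolyDominatedBound r P C} : ℝ≥0) : ℝ)

/-- The `r`-dominated multilinear maps. -/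
def dominatedMulti (r : ℝ) : MultiClass.{u, w} 𝕜 where
  mem T := ∃ C : ℝ≥0, MultiDominatedBound r T C
  nrm T := ((sInf {C : ℝ≥0 | MultiDominatedBound r T C} : ℝ≥0) : ℝ)

end Summing

end

end DominatedIdeals

namespace DominatedIdeals

/-! ## Inequalities for finite sums in `ℝ≥0∞` -/

/-! Extension by zero turns the definition of `Π_r` into an inequality over finite sequences
(`summingBound_iff`). All three classes then consist of the `v` with `f v i ≤ C * W i` for a
separating family of seminorms `f · i` and finite weights `W i`. For the dominated classes the
triangle inequality is Minkowski's in `ℓ_{r/n}`, which is where `n ≤ r` enters. Such a class is a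
normed space whose best constant is attained (`isQuasiNormedSubspace_of_seminorms`, `bound_sInf`).

Multiplication by functionals is Hölder's inequality: each new factor `γ (x i)` lies in `ℓ_r` with
norm at most `‖γ‖` times the weak norm, and `k/r + 1/r = (k+1)/r`. This gives (CP3), (CP4), (CH3),
(CH4) and the maps of finite type.

Freezing a variable at `a` is a self-improvement argument. Put `b i = T (a, x i)` and feed the
frozen variable the vectors `c i • a`, with `|c i|` a power of `‖b i‖` chosen so that both sides of
the domination inequality are powers of the same sum `S`. Since `S` is finite, the surplus power
cancels, with no loss in the constant. This gives (CP1) and (CH1).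

For polynomials, polarization bounds `‖P^∨ (x₁, …, xₙ)‖` by the values of `P` at the `2^n` partial
sums, so `P^∨` is dominated with constant `2^n n^n C` (`PolyDominatedBound.polar`). Hence (CP5) and
(CH5), and the freezing results pass to (CP2*) and (CH2*). Degrees are at most `N`, so `2^N N^N`
serves for all of them. -/

theorem sum_mul_rpow_le {ι : Type*} [Fintype ι] (f g : ι → ℝ≥0∞) {p q : ℝ} (hp : 0 ≤ p)
    (hq : 0 ≤ q) (hpq : p + q = 1) :
    ∑ i, f i ^ p * g i ^ q ≤ (∑ i, f i) ^ p * (∑ i, g i) ^ q := by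
  -- A finite sum is the integral against counting measure; the top σ-algebra makes every function
  -- measurable.
  let _ : MeasurableSpace ι := ⊤
  have h := ENNReal.lintegral_mul_norm_pow_le (μ := MeasureTheory.Measure.count)
    (measurable_from_top (f := f)).aemeasurable (measurable_from_top (f := g)).aemeasurable
    hp hq hpq
  simpa only [MeasureTheory.lintegral_count, tsum_fintype] using h

theorem sum_prod_rpow_le {ι κ : Type*} [Fintype ι] [Fintype κ] (f : κ → ι → ℝ≥0∞) {p : κ → ℝ}
    (hp : ∑ j, p j = 1) (hp0 : ∀ j, 0 ≤ p j) :
    ∑ i, ∏ j, f j i ^ p j ≤ ∏ j, (∑ i, f j i) ^ p j := by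
  let _ : MeasurableSpace ι := ⊤
  have h := ENNReal.lintegral_prod_norm_pow_le (μ := MeasureTheory.Measure.count) Finset.univ
    (fun j _ => (measurable_from_top (f := f j)).aemeasurable) hp (fun j _ => hp0 j)
  simpa only [MeasureTheory.lintegral_count, tsum_fintype] using h

/-- Hölder's inequality for `n` sequences in `ℓ_r`. -/
theorem sum_prod_le_prod_sum {ι : Type*} [Fintype ι] {n : ℕ} (hn : 1 ≤ n) {r : ℝ} (hr : 0 < r)
    (g : Fin n → ι → ℝ≥0∞) :
    (∑ i, (∏ j, g j i) ^ (r / n)) ^ ((n : ℝ) / r) ≤ ∏ j, (∑ i, g j i ^ r) ^ (1 / r) := by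
  have hn0 : (n : ℝ) ≠ 0 := by positivity
  have h := sum_prod_rpow_le (fun j i => g j i ^ r) (p := fun _ : Fin n => 1 / (n : ℝ))
    (by simp [hn0]) (fun _ => by positivity)
  have h' := ENNReal.rpow_le_rpow h (z := (n : ℝ) / r) (by positivity)
  rw [← ENNReal.prod_rpow_of_nonneg (by positivity)] at h'
  simp only [← ENNReal.rpow_mul] at h'
  convert h' using 4 with i hi j hj
  · rw [← ENNReal.prod_rpow_of_nonneg (by positivity)]
    simp only [mul_one_div]
  · field_simp

/-- Hölder's inequality for `ℓ_{r/k}` and `ℓ_r`. -/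
theorem sum_mul_le_mul_sum {ι : Type*} [Fintype ι] {k : ℕ} (hk : 1 ≤ k) {r : ℝ} (hr : 0 < r)
    (f g : ι → ℝ≥0∞) :
    (∑ i, (f i * g i) ^ (r / (k + 1 : ℕ))) ^ (((k + 1 : ℕ) : ℝ) / r) ≤
      (∑ i, f i ^ (r / k)) ^ ((k : ℝ) / r) * (∑ i, g i ^ r) ^ (1 / r) := by
  have hk0 : (k : ℝ) ≠ 0 := by positivity
  have hk1 : (k : ℝ) + 1 ≠ 0 := by positivity
  -- The weights are the shares of `k/r` and `1/r` in `(k+1)/r`.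
  have h := sum_mul_rpow_le (fun i => f i ^ (r / k)) (fun i => g i ^ r)
    (p := (k : ℝ) / (k + 1)) (q := 1 / ((k : ℝ) + 1)) (by positivity) (by positivity)
    (by field_simp)
  have h' := ENNReal.rpow_le_rpow h (z := ((k + 1 : ℕ) : ℝ) / r) (by positivity)
  rw [ENNReal.mul_rpow_of_nonneg _ _ (by positivity)] at h'
  simp only [← ENNReal.rpow_mul] at h'
  convert h' using 4 with i hi
  · rw [ENNReal.mul_rpow_of_nonneg _ _ (by positivity)]
    congr 2 <;> push_cast <;> field_simp
  · push_cast; field_simp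
  · push_cast; field_simp

/-- Minkowski's inequality for a finite family of sequences. -/
theorem sum_finset_sum_le {ι κ : Type*} [Fintype ι] (s : Finset κ) (f : κ → ι → ℝ≥0∞) {p : ℝ}
    (hp : 1 ≤ p) :
    (∑ i, (∑ j ∈ s, f j i) ^ p) ^ (1 / p) ≤ ∑ j ∈ s, (∑ i, f j i ^ p) ^ (1 / p) := by
  classical
  induction s using Finset.induction_on with
  | empty =>
    have : 0 < p := by linarith
    simp [ENNReal.zero_rpow_of_pos, this]
  | insert a s ha ih =>
    simp only [Finset.sum_insert ha]
    exact (ENNReal.Lp_add_le _ _ _ hp).trans (by gcongr)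

/-! ## The weak norm -/

section WeakNorm

variable {𝕜 : Type w} [RCLike 𝕜] {E F : Type u} [NormedAddCommGroup E] [NormedSpace 𝕜 E]
  [NormedAddCommGroup F] [NormedSpace 𝕜 F] {r : ℝ}

/-- Rescaling `φ` to norm one reduces the bound to the definition of the weak norm; `φ = 0` is
treated apart. -/
theorem le_weakNorm {ι : Type*} (hr : 0 < r) (φ : E →L[𝕜] 𝕜) (x : ι → E) :
    (∑' i, ‖φ (x i)‖ₑ ^ r) ^ (1 / r) ≤ ‖φ‖ₑ * weakNorm 𝕜 r x := by
  rcases eq_or_ne φ 0 with rfl | h0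
  · simp [ENNReal.zero_rpow_of_pos, hr]
  have hφ : ‖φ‖ ≠ 0 := norm_ne_zero_iff.2 h0
  set ψ : E →L[𝕜] 𝕜 := ((‖φ‖⁻¹ : ℝ) : 𝕜) • φ with hψ
  have hψ1 : ‖ψ‖ ≤ 1 := by
    rw [hψ, norm_smul, RCLike.norm_ofReal, abs_of_nonneg (by positivity), inv_mul_cancel₀ hφ]
  have hφψ : ∀ y, ‖φ y‖ₑ = ‖φ‖ₑ * ‖ψ y‖ₑ := by
    intro y
    have : φ y = ((‖φ‖ : ℝ) : 𝕜) • ψ y := by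
      have : ((‖φ‖ : ℝ) : 𝕜) ≠ 0 := by exact_mod_cast hφ
      simp only [hψ, smul_apply, smul_smul]
      rw [RCLike.ofReal_inv, mul_inv_cancel₀ this, one_smul]
    rw [this, enorm_smul]
    congr 1
    rw [← enorm_norm, RCLike.norm_ofReal, abs_norm, enorm_norm]
  calc (∑' i, ‖φ (x i)‖ₑ ^ r) ^ (1 / r)
      = ‖φ‖ₑ * (∑' i, ‖ψ (x i)‖ₑ ^ r) ^ (1 / r) := by
        simp only [hφψ, ENNReal.mul_rpow_of_nonneg _ _ hr.le, ENNReal.tsum_mul_left]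
        rw [ENNReal.mul_rpow_of_nonneg _ _ (by positivity), ← ENNReal.rpow_mul,
          mul_one_div_cancel hr.ne', ENNReal.rpow_one]
    _ ≤ _ := by
      gcongr
      exact le_iSup₂ (f := fun (φ : E →L[𝕜] 𝕜) (_ : ‖φ‖ ≤ 1) =>
        (∑' i, ‖φ (x i)‖ₑ ^ r) ^ (1 / r)) ψ hψ1

theorem sum_le_weakNorm {m : ℕ} (hr : 0 < r) (φ : E →L[𝕜] 𝕜) (x : Fin m → E) :
    (∑ i, ‖φ (x i)‖ₑ ^ r) ^ (1 / r) ≤ ‖φ‖ₑ * weakNorm 𝕜 r x := by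
  simpa only [tsum_fintype] using le_weakNorm hr φ x

theorem enorm_apply_le_of_norm_le_one {φ : E →L[𝕜] 𝕜} (hφ : ‖φ‖ ≤ 1) (x : E) :
    ‖φ x‖ₑ ≤ ‖x‖ₑ := by
  rw [enorm_le_iff_norm_le]
  simpa using φ.le_of_opNorm_le hφ x

theorem weakNorm_le_of_sum_le {ι : Type*} {x : ι → E} {D : ℝ≥0∞}
    (h : ∀ φ : E →L[𝕜] 𝕜, ‖φ‖ ≤ 1 → (∑' i, ‖φ (x i)‖ₑ ^ r) ^ (1 / r) ≤ D) :
    weakNorm 𝕜 r x ≤ D :=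
  iSup₂_le h

theorem weakNorm_le_sum {m : ℕ} (hr : 0 < r) (x : Fin m → E) :
    weakNorm 𝕜 r x ≤ (∑ i, ‖x i‖ₑ ^ r) ^ (1 / r) := by
  refine weakNorm_le_of_sum_le fun φ hφ => ?_
  rw [tsum_fintype]
  gcongr
  exact enorm_apply_le_of_norm_le_one hφ _

theorem weakNorm_ne_top {m : ℕ} (hr : 0 < r) (x : Fin m → E) : weakNorm 𝕜 r x ≠ ∞ := by
  refine ne_top_of_le_ne_top ?_ (weakNorm_le_sum hr x)
  refine ENNReal.rpow_ne_top_of_nonneg (by positivity) (ENNReal.sum_ne_top.2 fun i _ => ?_)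
  exact ENNReal.rpow_ne_top_of_nonneg hr.le enorm_ne_top

theorem weakNorm_single_le (hr : 0 < r) (x : E) : weakNorm 𝕜 r (fun _ : Fin 1 => x) ≤ ‖x‖ₑ := by
  refine (weakNorm_le_sum hr _).trans_eq ?_
  simp [← ENNReal.rpow_mul, hr.ne']

/-- Every functional kills each `x i`, and by Hahn–Banach functionals separate points. -/
theorem eq_zero_of_weakNorm_eq_zero {ι : Type*} (hr : 0 < r) {x : ι → E}
    (h : weakNorm 𝕜 r x = 0) (i : ι) : x i = 0 := by
  refine (SeparatingDual.eq_zero_iff_forall_dual_eq_zero (R := 𝕜) (x i)).2 fun φ => ?_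
  have h1 := le_weakNorm hr φ x
  rw [h, mul_zero, nonpos_iff_eq_zero, ENNReal.rpow_eq_zero_iff_of_pos (by positivity),
    ENNReal.tsum_eq_zero] at h1
  simpa [hr, hr.ne', ENNReal.rpow_eq_zero_iff_of_pos hr] using h1 i

theorem weakNorm_comp_le {ι : Type*} (hr : 0 < r) (t : E →L[𝕜] F) (x : ι → E) :
    weakNorm 𝕜 r (fun i => t (x i)) ≤ ‖t‖ₑ * weakNorm 𝕜 r x := by
  refine weakNorm_le_of_sum_le fun φ hφ => ?_
  refine (le_weakNorm hr (φ ∘L t) x).trans ?_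
  gcongr
  rw [enorm_le_iff_norm_le]
  exact (φ.opNorm_comp_le t).trans (mul_le_of_le_one_left (norm_nonneg _) hφ)

theorem weakNorm_const_smul_le {ι : Type*} (hr : 0 < r) (c : 𝕜) (x : ι → E) :
    weakNorm 𝕜 r (fun i => c • x i) ≤ ‖c‖ₑ * weakNorm 𝕜 r x := by
  refine (weakNorm_comp_le hr (c • ContinuousLinearMap.id 𝕜 E) x).trans ?_
  gcongr
  rw [enorm_le_iff_norm_le, norm_smul]
  exact mul_le_of_le_one_right (norm_nonneg _) ContinuousLinearMap.norm_id_le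

/-- Bounds the weak norm of the test vectors inserted in a frozen variable: the strong norm of
multiples of one vector factors. -/
theorem weakNorm_smul_const_le {m : ℕ} (hr : 0 < r) (l : Fin m → 𝕜) (a : E) :
    weakNorm 𝕜 r (fun i => l i • a) ≤ ‖a‖ₑ * (∑ i, ‖l i‖ₑ ^ r) ^ (1 / r) := by
  refine (weakNorm_le_sum hr _).trans_eq ?_
  simp only [enorm_smul, ENNReal.mul_rpow_of_nonneg _ _ hr.le, ← Finset.sum_mul]
  rw [ENNReal.mul_rpow_of_nonneg _ _ (by positivity), ← ENNReal.rpow_mul,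
    mul_one_div_cancel hr.ne', ENNReal.rpow_one, mul_comm]

theorem weakNorm_sum_le {m : ℕ} {κ : Type*} (hr : 1 ≤ r) (s : Finset κ) (x : κ → Fin m → E) :
    weakNorm 𝕜 r (fun i => ∑ j ∈ s, x j i) ≤ ∑ j ∈ s, weakNorm 𝕜 r (x j) := by
  have hr0 : 0 < r := by linarith
  refine weakNorm_le_of_sum_le fun φ hφ => ?_
  rw [tsum_fintype]
  calc (∑ i, ‖φ (∑ j ∈ s, x j i)‖ₑ ^ r) ^ (1 / r)
      ≤ (∑ i, (∑ j ∈ s, ‖φ (x j i)‖ₑ) ^ r) ^ (1 / r) := by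
        gcongr with i
        rw [map_sum]
        exact enorm_sum_le _ _
    _ ≤ _ := sum_finset_sum_le s _ hr
    _ ≤ _ := by
      refine Finset.sum_le_sum fun j _ => (sum_le_weakNorm hr0 φ (x j)).trans ?_
      refine mul_le_of_le_one_left (by positivity) ?_
      rwa [← enorm_one (G := ℝ), enorm_le_iff_norm_le, norm_one]

theorem weakNorm_comp_injective_le {ι κ : Type*} (hr : 0 < r) (x : ι → E) {e : κ → ι}
    (he : Function.Injective e) : weakNorm 𝕜 r (fun i => x (e i)) ≤ weakNorm 𝕜 r x := by
  refine iSup₂_mono fun φ _ => ?_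
  gcongr
  exact ENNReal.tsum_comp_le_tsum_of_injective he fun i => ‖φ (x i)‖ₑ ^ r

/-! ## Absolutely summing operators through finite sequences -/

/-- A finite sequence extended by zero has vanishing tails, so it belongs to `lru`. Conversely, an
infinite sum is the supremum of its partial sums, and an initial segment has smaller weak norm than
the whole sequence. -/
theorem summingBound_iff (hr : 0 < r) (v : E →L[𝕜] F) (C : ℝ≥0) :
    SummingBound r v C ↔ ∀ (m : ℕ) (x : Fin m → E),
      (∑ i, ‖v (x i)‖ₑ ^ r) ^ (1 / r) ≤ C * weakNorm 𝕜 r x := by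
  constructor
  · intro h m x
    set y : ℕ → E := fun j => if hj : j < m then x ⟨j, hj⟩ else 0 with hy
    have hyx : ∀ i : Fin m, y i = x i := fun i => by simp [hy]
    have hy0 : ∀ j, m ≤ j → y j = 0 := fun j hj => by simp [hy, hj]
    have hsum : ∀ f : E → ℝ≥0∞, f 0 = 0 → ∑' j, f (y j) = ∑ i, f (x i) := by
      intro f hf
      rw [tsum_eq_sum (s := Finset.range m)
        (fun j hj => by rw [hy0 j (by simpa using hj), hf]), Finset.sum_range]
      simp only [hyx]
    have hmem : y ∈ lru 𝕜 r E := by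
      refine ⟨fun φ => ?_, ?_⟩
      · refine summable_of_ne_finset_zero (s := Finset.range m) fun j hj => ?_
        rw [hy0 j (by simpa using hj)]
        simp [hr.ne']
      · refine tendsto_const_nhds.congr' ?_
        filter_upwards [eventually_ge_atTop m] with j hj
        refine (nonpos_iff_eq_zero.1 (weakNorm_le_of_sum_le fun φ _ => ?_)).symm
        simp [hy0 _ (le_add_left hj), ENNReal.zero_rpow_of_pos, hr]
    have h1 := h y hmem
    rw [hsum (fun z => ‖v z‖ₑ ^ r) (by simp [hr])] at h1
    refine h1.trans ?_
    gcongr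
    refine weakNorm_le_of_sum_le fun φ hφ => ?_
    rw [hsum (fun z => ‖φ z‖ₑ ^ r) (by simp [hr]), ← tsum_fintype (L := .unconditional _)]
    exact le_iSup₂ (f := fun (φ : E →L[𝕜] 𝕜) (_ : ‖φ‖ ≤ 1) =>
        (∑' i, ‖φ (x i)‖ₑ ^ r) ^ (1 / r)) φ hφ
  · intro h x _
    rw [one_div, ENNReal.rpow_inv_le_iff hr, ENNReal.tsum_eq_iSup_nat]
    refine iSup_le fun m => ?_
    rw [← ENNReal.rpow_inv_le_iff hr, Finset.sum_range, ← one_div]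
    refine (h m fun i => x i).trans ?_
    gcongr
    exact weakNorm_comp_injective_le hr x Fin.val_injective

end WeakNorm

/-! ## Least bounds -/

section Bounds

/-- Since each `W i` is finite, `C ↦ C * W i` is continuous, so the admissible constants form a
closed set and the infimum is attained. Norm estimates can therefore start from the best constant
itself. -/
theorem bound_sInf {L : Type*} {f W : L → ℝ≥0∞} (hW : ∀ i, W i ≠ ∞) {B : ℝ≥0 → Prop}
    (hB : ∀ C, B C ↔ ∀ i, f i ≤ C * W i) (h : ∃ C, B C) : B (sInf {C | B C}) := by
  have hcl : IsClosed {C | B C} := by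
    have : {C | B C} = ⋂ i, {C : ℝ≥0 | f i ≤ C * W i} := by
      ext C
      simp [hB]
    rw [this]
    exact isClosed_iInter fun i => isClosed_le continuous_const
      ((ENNReal.continuous_mul_const (hW i)).comp ENNReal.continuous_coe)
  exact hcl.csInf_mem h (OrderBot.bddBelow _)

/-- The elements dominated by a family of seminorms form a normed subspace. -/
theorem isQuasiNormedSubspace_of_seminorms {𝕜 : Type w} [RCLike 𝕜] {V : Type*} [AddCommGroup V]
    [Module 𝕜 V] {ι : Type*} (f : V → ι → ℝ≥0∞) {W : ι → ℝ≥0∞} (hW : ∀ i, W i ≠ ∞)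
    {B : V → ℝ≥0 → Prop} (hB : ∀ v C, B v C ↔ ∀ i, f v i ≤ C * W i)
    (hadd : ∀ v v' i, f (v + v') i ≤ f v i + f v' i)
    (hsmul : ∀ (c : 𝕜) v i, f (c • v) i = ‖c‖ₑ * f v i)
    (hsep : ∀ v, (∀ i, f v i = 0) → v = 0) :
    IsQuasiNormedSubspace 𝕜 (fun v => ∃ C, B v C)
      (fun v => ((sInf {C | B v C} : ℝ≥0) : ℝ)) 1 := by
  have hle : ∀ {v C}, B v C → sInf {C | B v C} ≤ C := fun h => csInf_le' h
  have hmem : ∀ v, (∃ C, B v C) → B v (sInf {C | B v C}) := fun v => bound_sInf hW (hB v)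
  have hB0 : B 0 0 := by
    rw [hB]
    intro i
    have := hsmul 0 0 i
    rw [zero_smul, enorm_zero, zero_mul] at this
    simp [this]
  have hBsmul : ∀ (c : 𝕜) v C, B v C → B (c • v) (‖c‖₊ * C) := by
    intro c v C h
    rw [hB] at h ⊢
    intro i
    rw [hsmul, ENNReal.coe_mul, mul_assoc]
    exact mul_le_mul_right (h i) _
  have hBadd : ∀ v v' C C', B v C → B v' C' → B (v + v') (C + C') := by
    intro v v' C C' h h'
    rw [hB] at h h' ⊢
    intro i
    rw [ENNReal.coe_add, add_mul]
    exact (hadd _ _ _).trans (add_le_add (h i) (h' i))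
  refine ⟨⟨0, hB0⟩, ?_, ?_, fun _ _ => NNReal.coe_nonneg _, ?_, ?_, ?_⟩
  · rintro x y ⟨C, hC⟩ ⟨D, hD⟩
    exact ⟨_, hBadd _ _ _ _ hC hD⟩
  · rintro c x ⟨C, hC⟩
    exact ⟨_, hBsmul c _ _ hC⟩
  · intro x hx
    constructor
    · intro h
      have h1 := hmem x hx
      rw [NNReal.coe_eq_zero.1 h, hB] at h1
      exact hsep x fun i => by simpa using h1 i
    · rintro rfl
      exact NNReal.coe_eq_zero.2 (nonpos_iff_eq_zero.1 (hle hB0))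
  · intro c x hx
    rcases eq_or_ne c 0 with rfl | hc
    · rw [zero_smul, norm_zero, zero_mul]
      exact NNReal.coe_eq_zero.2 (nonpos_iff_eq_zero.1 (hle hB0))
    have hcn : ‖c‖₊ ≠ 0 := nnnorm_ne_zero_iff.2 hc
    rw [← coe_nnnorm, ← NNReal.coe_mul, NNReal.coe_inj]
    refine le_antisymm (hle (hBsmul c x _ (hmem x hx))) ?_
    -- The reverse inequality is the same estimate for `c⁻¹` applied to `c • x`.
    have h1 := hBsmul c⁻¹ _ _ (hmem (c • x) ⟨_, hBsmul c x _ (hmem x hx)⟩)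
    rw [inv_smul_smul₀ hc] at h1
    calc _ ≤ ‖c‖₊ * (‖c⁻¹‖₊ * sInf {C | B (c • x) C}) := by
          gcongr
          exact hle h1
      _ = _ := by rw [nnnorm_inv, mul_inv_cancel_left₀ hcn]
  · intro x y hx hy
    rw [one_mul]
    exact_mod_cast hle (hBadd _ _ _ _ (hmem x hx) (hmem y hy))

theorem exists_and_sInf_le {B : ℝ≥0 → Prop} {C : ℝ≥0} {D : ℝ} (h : B C) (hCD : (C : ℝ) ≤ D) :
    (∃ C, B C) ∧ ((sInf {C | B C} : ℝ≥0) : ℝ) ≤ D :=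
  ⟨⟨C, h⟩, (NNReal.coe_le_coe.2 (csInf_le' h)).trans hCD⟩

theorem sInf_eq_one_of_bound {B : ℝ≥0 → Prop} (h : B 1) (h' : ∀ C, B C → 1 ≤ C) :
    ((sInf {C | B C} : ℝ≥0) : ℝ) = 1 := by
  rw [NNReal.coe_eq_one]
  exact IsLeast.csInf_eq ⟨h, h'⟩

end Bounds

/-! ## The three classes as spaces dominated by seminorms -/

section Classes

variable {𝕜 : Type w} [RCLike 𝕜] {E F G H : Type u} [NormedAddCommGroup E] [NormedSpace 𝕜 E]
  [NormedAddCommGroup F] [NormedSpace 𝕜 F] [NormedAddCommGroup G] [NormedSpace 𝕜 G]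
  [NormedAddCommGroup H] [NormedSpace 𝕜 H] {r : ℝ} {n : ℕ}

/-- The hypothesis `n ≤ r` makes `r / n ≥ 1`, so `ℓ_{r/n}` satisfies the triangle inequality without
a constant. -/
theorem sum_rpow_add_le {m : ℕ} (hn : 1 ≤ n) (hnr : (n : ℝ) ≤ r) (f g h : Fin m → ℝ≥0∞)
    (hf : ∀ i, f i ≤ g i + h i) :
    (∑ i, f i ^ (r / n)) ^ ((n : ℝ) / r) ≤
      (∑ i, g i ^ (r / n)) ^ ((n : ℝ) / r) + (∑ i, h i ^ (r / n)) ^ ((n : ℝ) / r) := by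
  have hn0 : (0 : ℝ) < n := by positivity
  have hr0 : 0 < r := by linarith
  rw [← one_div_div r n]
  refine le_trans ?_ (ENNReal.Lp_add_le _ _ _ ((one_le_div hn0).2 hnr))
  gcongr with i
  exact hf i

theorem sum_rpow_mul_left {m : ℕ} (hn : 1 ≤ n) (hr : 0 < r) (c : ℝ≥0∞) (g : Fin m → ℝ≥0∞) :
    (∑ i, (c * g i) ^ (r / n)) ^ ((n : ℝ) / r) =
      c * (∑ i, g i ^ (r / n)) ^ ((n : ℝ) / r) := by
  have hn0 : (0 : ℝ) < n := by positivity
  simp only [ENNReal.mul_rpow_of_nonneg _ _ (show 0 ≤ r / n by positivity), ← Finset.mul_sum]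
  rw [ENNReal.mul_rpow_of_nonneg _ _ (by positivity), ← ENNReal.rpow_mul,
    div_mul_div_cancel₀ hn0.ne', div_self hr.ne', ENNReal.rpow_one]

/-- One-term sequences recover pointwise norms. They separate points in the dominated classes and
give the lower bound in the normalisation. -/
theorem sum_single_rpow (hn : 1 ≤ n) (hr : 0 < r) (c : ℝ≥0∞) :
    (∑ _i : Fin 1, c ^ (r / n)) ^ ((n : ℝ) / r) = c := by
  have hn0 : (0 : ℝ) < n := by positivity
  rw [Fin.sum_univ_one, ← ENNReal.rpow_mul, div_mul_div_cancel₀ hn0.ne', div_self hr.ne',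
    ENNReal.rpow_one]

theorem multi_isQuasiNormedSubspace (hn : 1 ≤ n) (hnr : (n : ℝ) ≤ r) (E : Fin n → Type u)
    (F : Type u) [∀ i, NormedAddCommGroup (E i)] [∀ i, NormedSpace 𝕜 (E i)]
    [NormedAddCommGroup F] [NormedSpace 𝕜 F] :
    IsQuasiNormedSubspace 𝕜
      (fun T : ContinuousMultilinearMap 𝕜 E F => ∃ C, MultiDominatedBound r T C)
      (fun T => ((sInf {C : ℝ≥0 | MultiDominatedBound r T C} : ℝ≥0) : ℝ)) 1 := by
  have hr0 : 0 < r := lt_of_lt_of_le (by positivity) hnr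
  refine isQuasiNormedSubspace_of_seminorms
    (fun (T : ContinuousMultilinearMap 𝕜 E F) (p : Σ m : ℕ, ∀ j, Fin m → E j) =>
      (∑ i, ‖T fun j => p.2 j i‖ₑ ^ (r / n)) ^ ((n : ℝ) / r))
    (W := fun p => ∏ j, weakNorm 𝕜 r (p.2 j))
    (fun p => ENNReal.prod_ne_top fun j _ => weakNorm_ne_top hr0 _)
    (fun T C => ⟨fun h p => h p.1 p.2, fun h m x => h ⟨m, x⟩⟩)
    (fun S T p => sum_rpow_add_le hn hnr _ _ _ fun i => enorm_add_le _ _)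
    (fun c T p => ?_) (fun T h => ?_)
  · simp only [smul_apply, enorm_smul]
    exact sum_rpow_mul_left hn hr0 _ _
  · ext x
    -- Testing on one-term sequences shows that `T` vanishes at every point.
    have h1 := h ⟨1, fun j _ => x j⟩
    simpa [sum_single_rpow hn hr0] using (sum_single_rpow hn hr0 _).symm.trans h1

theorem poly_isQuasiNormedSubspace (hn : 1 ≤ n) (hnr : (n : ℝ) ≤ r) (E F : Type u)
    [NormedAddCommGroup E] [NormedSpace 𝕜 E] [NormedAddCommGroup F] [NormedSpace 𝕜 F] :
    IsQuasiNormedSubspace 𝕜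
      (fun P : HomPoly 𝕜 n E F => ∃ C, PolyDominatedBound r P C)
      (fun P => ((sInf {C : ℝ≥0 | PolyDominatedBound r P C} : ℝ≥0) : ℝ)) 1 := by
  have hr0 : 0 < r := lt_of_lt_of_le (by positivity) hnr
  refine isQuasiNormedSubspace_of_seminorms
    (fun (P : HomPoly 𝕜 n E F) (p : Σ m : ℕ, Fin m → E) =>
      (∑ i, ‖P.1 (p.2 i)‖ₑ ^ (r / n)) ^ ((n : ℝ) / r))
    (W := fun p => weakNorm 𝕜 r p.2 ^ n)
    (fun p => ENNReal.pow_ne_top (weakNorm_ne_top hr0 _))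
    (fun T C => ⟨fun h p => h p.1 p.2, fun h m x => h ⟨m, x⟩⟩)
    (fun S T p => sum_rpow_add_le hn hnr _ _ _ fun i => enorm_add_le _ _)
    (fun c T p => ?_) (fun P h => ?_)
  · simp only [Submodule.coe_smul, Pi.smul_apply, enorm_smul]
    exact sum_rpow_mul_left hn hr0 _ _
  · ext x
    have h1 := h ⟨1, fun _ => x⟩
    simpa using (sum_single_rpow hn hr0 _).symm.trans h1

theorem summing_isQuasiNormedSubspace (hr : 1 ≤ r) (E F : Type u)
    [NormedAddCommGroup E] [NormedSpace 𝕜 E] [NormedAddCommGroup F] [NormedSpace 𝕜 F] :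
    IsQuasiNormedSubspace 𝕜
      (fun v : E →L[𝕜] F => ∃ C, SummingBound r v C)
      (fun v => ((sInf {C : ℝ≥0 | SummingBound r v C} : ℝ≥0) : ℝ)) 1 := by
  have hr0 : 0 < r := by linarith
  refine isQuasiNormedSubspace_of_seminorms
    (fun (v : E →L[𝕜] F) (p : Σ m : ℕ, Fin m → E) =>
      (∑ i, ‖v (p.2 i)‖ₑ ^ r) ^ (1 / r))
    (W := fun p => weakNorm 𝕜 r p.2) (fun p => weakNorm_ne_top hr0 _)
    (fun T C => (summingBound_iff hr0 T C).trans
      ⟨fun h p => h p.1 p.2, fun h m x => h ⟨m, x⟩⟩)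
    (fun S T p => ?_) (fun c T p => ?_) (fun P h => ?_)
  · simpa using sum_rpow_add_le le_rfl (by simpa using hr) (fun i => ‖(S + T) (p.2 i)‖ₑ)
      (fun i => ‖S (p.2 i)‖ₑ) (fun i => ‖T (p.2 i)‖ₑ) fun i => enorm_add_le _ _
  · simpa [enorm_smul] using sum_rpow_mul_left le_rfl hr0 ‖c‖ₑ fun i => ‖T (p.2 i)‖ₑ
  · ext x
    have h1 := h ⟨1, fun _ => x⟩
    simpa [hr0, hr0.not_gt] using h1

theorem MultiDominatedBound.sInf {E : Fin n → Type u} [∀ i, NormedAddCommGroup (E i)]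
    [∀ i, NormedSpace 𝕜 (E i)] (hr : 0 < r) {T : ContinuousMultilinearMap 𝕜 E F}
    (h : ∃ C, MultiDominatedBound r T C) :
    MultiDominatedBound r T (sInf {C | MultiDominatedBound r T C}) :=
  bound_sInf (L := Σ m : ℕ, ∀ j, Fin m → E j) (W := fun p => ∏ j, weakNorm 𝕜 r (p.2 j))
    (f := fun p => (∑ i, ‖T fun j => p.2 j i‖ₑ ^ (r / n)) ^ ((n : ℝ) / r))
    (fun _ => ENNReal.prod_ne_top fun _ _ => weakNorm_ne_top hr _)
    (fun _ => ⟨fun h p => h p.1 p.2, fun h m x => h ⟨m, x⟩⟩) h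

theorem PolyDominatedBound.sInf (hr : 0 < r) {P : HomPoly 𝕜 n E F}
    (h : ∃ C, PolyDominatedBound r P C) :
    PolyDominatedBound r P (sInf {C | PolyDominatedBound r P C}) :=
  bound_sInf (L := Σ m : ℕ, Fin m → E) (W := fun p => weakNorm 𝕜 r p.2 ^ n)
    (f := fun p => (∑ i, ‖P.1 (p.2 i)‖ₑ ^ (r / n)) ^ ((n : ℝ) / r))
    (fun _ => ENNReal.pow_ne_top (weakNorm_ne_top hr _))
    (fun _ => ⟨fun h p => h p.1 p.2, fun h m x => h ⟨m, x⟩⟩) h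

theorem SummingBound.sInf (hr : 0 < r) {v : E →L[𝕜] F} (h : ∃ C, SummingBound r v C) :
    SummingBound r v (sInf {C | SummingBound r v C}) :=
  bound_sInf (L := Σ m : ℕ, Fin m → E) (W := fun p => weakNorm 𝕜 r p.2)
    (f := fun p => (∑ i, ‖v (p.2 i)‖ₑ ^ r) ^ (1 / r))
    (fun _ => weakNorm_ne_top hr _) (fun C => (summingBound_iff hr v C).trans
      ⟨fun h p => h p.1 p.2, fun h m x => h ⟨m, x⟩⟩) h

end Classes

/-! ## Dominated multilinear maps -/

section Multi

variable {𝕜 : Type w} [RCLike 𝕜] {r : ℝ} {n k : ℕ} {F H : Type u}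
  [NormedAddCommGroup F] [NormedSpace 𝕜 F] [NormedAddCommGroup H] [NormedSpace 𝕜 H]

theorem MultiDominatedBound.comp {E G : Fin n → Type u}
    [∀ i, NormedAddCommGroup (E i)] [∀ i, NormedSpace 𝕜 (E i)]
    [∀ i, NormedAddCommGroup (G i)] [∀ i, NormedSpace 𝕜 (G i)] (hn : 1 ≤ n) (hr : 0 < r)
    {T : ContinuousMultilinearMap 𝕜 E F} {C : ℝ≥0} (h : MultiDominatedBound r T C)
    (w : F →L[𝕜] H) (t : ∀ i, G i →L[𝕜] E i) :
    MultiDominatedBound r (w.compContinuousMultilinearMap (T.compContinuousLinearMap t))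
      (‖w‖₊ * C * ∏ i, ‖t i‖₊) := by
  intro m x
  calc _ ≤ (∑ i, (‖w‖ₑ * ‖T fun j => t j (x j i)‖ₑ) ^ (r / n)) ^ ((n : ℝ) / r) := by
        gcongr with i
        exact w.le_opENorm _
    _ ≤ ‖w‖ₑ * (C * ∏ j, (‖t j‖ₑ * weakNorm 𝕜 r (x j))) := by
        rw [sum_rpow_mul_left hn hr]
        gcongr
        refine (h m fun j i => t j (x j i)).trans ?_
        gcongr with j
        exact weakNorm_comp_le hr _ _
    _ = _ := by
        rw [Finset.prod_mul_distrib]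
        push_cast
        simp only [enorm_eq_nnnorm]
        ring

/-- A map bounded by a product of functionals is dominated. -/
theorem multiDominatedBound_of_le_prod {E : Fin n → Type u}
    [∀ i, NormedAddCommGroup (E i)] [∀ i, NormedSpace 𝕜 (E i)] (hn : 1 ≤ n) (hr : 0 < r)
    {T : ContinuousMultilinearMap 𝕜 E F} (γ : ∀ i, E i →L[𝕜] 𝕜) (D : ℝ≥0)
    (h : ∀ x, ‖T x‖ₑ ≤ D * ∏ i, ‖γ i (x i)‖ₑ) :
    MultiDominatedBound r T (D * ∏ i, ‖γ i‖₊) := by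
  intro m x
  calc _ ≤ (∑ i, (D * ∏ j, ‖γ j (x j i)‖ₑ) ^ (r / n)) ^ ((n : ℝ) / r) := by
        gcongr with i
        exact h _
    _ ≤ D * ∏ j, (‖γ j‖ₑ * weakNorm 𝕜 r (x j)) := by
        rw [sum_rpow_mul_left hn hr]
        gcongr
        refine (sum_prod_le_prod_sum hn hr fun j i => ‖γ j (x j i)‖ₑ).trans ?_
        gcongr with j
        exact sum_le_weakNorm hr _ _
    _ = _ := by
        rw [Finset.prod_mul_distrib]
        push_cast
        simp only [enorm_eq_nnnorm]
        ring

theorem MultiDominatedBound.functionalMul {E : Fin (k + 1) → Type u}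
    [∀ i, NormedAddCommGroup (E i)] [∀ i, NormedSpace 𝕜 (E i)] (hk : 1 ≤ k) (hr : 0 < r)
    (γ : E (Fin.last k) →L[𝕜] 𝕜)
    {T : ContinuousMultilinearMap 𝕜 (fun i : Fin k => E i.castSucc) F} {C : ℝ≥0}
    (h : MultiDominatedBound r T C) :
    MultiDominatedBound r (functionalMulMulti γ T) (‖γ‖₊ * C) := by
  intro m x
  calc _ = (∑ i, (‖T fun j => x j.castSucc i‖ₑ * ‖γ (x (Fin.last k) i)‖ₑ) ^
        (r / (k + 1 : ℕ))) ^ (((k + 1 : ℕ) : ℝ) / r) := by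
        simp only [functionalMulMulti_apply, enorm_smul, mul_comm]
    _ ≤ (C * ∏ j : Fin k, weakNorm 𝕜 r (x j.castSucc)) *
        (‖γ‖ₑ * weakNorm 𝕜 r (x (Fin.last k))) :=
        (sum_mul_le_mul_sum hk hr _ _).trans
          (mul_le_mul' (h m fun j => x j.castSucc) (sum_le_weakNorm hr _ _))
    _ = _ := by
        rw [Fin.prod_univ_castSucc]
        push_cast
        simp only [enorm_eq_nnnorm]
        ring

theorem multiDominatedBound_functionalsMulLinear {E : Fin (k + 1) → Type u}
    [∀ i, NormedAddCommGroup (E i)] [∀ i, NormedSpace 𝕜 (E i)] (hr : 0 < r)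
    (γ : ∀ i : Fin k, E i.castSucc →L[𝕜] 𝕜) {v : E (Fin.last k) →L[𝕜] F} {C : ℝ≥0}
    (h : SummingBound r v C) :
    MultiDominatedBound r (functionalsMulLinear γ v) ((∏ i, ‖γ i‖₊) * C) := by
  rw [summingBound_iff hr] at h
  intro m x
  -- The norms `‖v (x i)‖` are taken as the last of `k + 1` sequences in `ℓ_r`, beside the `k`
  -- sequences of functional values.
  have h1 := sum_prod_le_prod_sum (n := k + 1) (by simp) hr
    (Fin.snoc (α := fun _ => Fin m → ℝ≥0∞) (fun j i => ‖γ j (x j.castSucc i)‖ₑ)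
      fun i => ‖v (x (Fin.last k) i)‖ₑ)
  simp only [Fin.prod_univ_castSucc, Fin.snoc_castSucc, Fin.snoc_last] at h1
  have hprod : ∀ f : Fin k → 𝕜, ‖∏ i, f i‖ₑ = ∏ i, ‖f i‖ₑ := fun f => by
    simp [enorm_eq_nnnorm, nnnorm_prod]
  calc _ = (∑ i, ((∏ j : Fin k, ‖γ j (x j.castSucc i)‖ₑ) * ‖v (x (Fin.last k) i)‖ₑ) ^
        (r / (k + 1 : ℕ))) ^ (((k + 1 : ℕ) : ℝ) / r) := by
        simp only [functionalsMulLinear_apply, enorm_smul, hprod]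
    _ ≤ (∏ j : Fin k, (‖γ j‖ₑ * weakNorm 𝕜 r (x j.castSucc))) *
        (C * weakNorm 𝕜 r (x (Fin.last k))) := by
        refine h1.trans (mul_le_mul' ?_ (h m _))
        gcongr with j
        exact sum_le_weakNorm hr _ _
    _ = _ := by
        rw [Fin.prod_univ_castSucc, Finset.prod_mul_distrib]
        push_cast
        simp only [enorm_eq_nnnorm]
        ring

/-! ### Freezing variables of dominated multilinear maps -/

theorem ofReal_rpow_enorm {G : Type*} [SeminormedAddCommGroup G] {a : G} {s : ℝ} (hs : 0 ≤ s) :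
    ‖((‖a‖ ^ s : ℝ) : 𝕜)‖ₑ = ‖a‖ₑ ^ s := by
  rw [← enorm_norm, RCLike.norm_ofReal, abs_of_nonneg (by positivity),
    Real.enorm_rpow_of_nonneg (norm_nonneg _) hs, enorm_norm]

/-- The cancellation behind freezing: `S ^ p` can be divided out because `S` is finite, the case `S
= 0` being trivial. -/
theorem le_of_rpow_le_mul_rpow {S D : ℝ≥0∞} {p q s : ℝ} (hS : S ≠ ∞) (hq : 0 < q)
    (hpq : s = q + p) (h : S ^ s ≤ D * S ^ p) : S ^ q ≤ D := by
  rcases eq_or_ne S 0 with rfl | h0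
  · simp [hq]
  rw [hpq, ENNReal.rpow_add _ _ h0 hS] at h
  exact (ENNReal.mul_le_mul_iff_left (by simp [h0, hS]) (by simp [h0, hS])).1 h

theorem sum_enorm_rpow_ne_top {m : ℕ} {p : ℝ} (hp : 0 ≤ p) (y : Fin m → F) :
    ∑ i, ‖y i‖ₑ ^ p ≠ ∞ :=
  ENNReal.sum_ne_top.2 fun _ _ => ENNReal.rpow_ne_top_of_nonneg hp enorm_ne_top

/-- Freezing one variable: insert the multiples `‖T (a, x_i)‖^{1/k} a` of `a` in that variable. -/
theorem MultiDominatedBound.curryMid {E : Fin (k + 1) → Type u}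
    [∀ i, NormedAddCommGroup (E i)] [∀ i, NormedSpace 𝕜 (E i)] (hk : 1 ≤ k) (hr : 0 < r)
    {T : ContinuousMultilinearMap 𝕜 E F} {C : ℝ≥0} (h : MultiDominatedBound r T C)
    (j : Fin (k + 1)) (a : E j) :
    MultiDominatedBound r (T.curryMid j a) (C * ‖a‖₊) := by
  intro m x
  set b : Fin m → F := fun i => T.curryMid j a fun l => x l i with hb
  set c : Fin m → 𝕜 := fun i => ((‖b i‖ ^ (1 / (k : ℝ)) : ℝ) : 𝕜) with hc
  have hce : ∀ i, ‖c i‖ₑ = ‖b i‖ₑ ^ (1 / (k : ℝ)) := fun i => ofReal_rpow_enorm (by positivity)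
  -- The inserted scalar gives `‖b i‖ ^ (1 + 1/k)`, and `(1 + 1/k) * r / (k + 1) = r / k`: the left
  -- side involves the very sum to be estimated.
  have hT : ∀ i, ‖T fun l =>
      (j.insertNth (α := fun l => Fin m → E l) (fun i => c i • a) x) l i‖ₑ ^ (r / (k + 1 : ℕ)) =
      ‖b i‖ₑ ^ (r / k) := by
    intro i
    have h2 : (T fun l => (j.insertNth (α := fun l => Fin m → E l) (fun i => c i • a) x) l i) =
        c i • b i := by
      have h3 : c i • b i = T.curryMid j (c i • a) fun l => x l i := by
        rw [map_smul, smul_apply]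
      rw [h3, ContinuousMultilinearMap.curryMid_apply]
      congr 1
      ext l
      rcases Fin.eq_self_or_eq_succAbove j l with rfl | ⟨l, rfl⟩ <;> simp
    rw [h2, enorm_smul, hce]
    nth_rw 2 [← ENNReal.rpow_one ‖b i‖ₑ]
    rw [← ENNReal.rpow_add_of_nonneg _ _ (by positivity) zero_le_one, ← ENNReal.rpow_mul]
    congr 1
    push_cast
    field_simp
    ring
  have h1 := h m (j.insertNth (α := fun l => Fin m → E l) (fun i => c i • a) x)
  simp only [hT, Fin.prod_univ_succAbove _ j, Fin.insertNth_apply_same,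
    Fin.insertNth_apply_succAbove] at h1
  -- With `S = ∑ ‖b i‖ ^ (r/k)`, the weak norm of `c i • a` is at most `‖a‖ S^{1/r}`; cancelling it
  -- from `S^{(k+1)/r}` leaves `S^{k/r}`.
  refine le_of_rpow_le_mul_rpow (s := ((k + 1 : ℕ) : ℝ) / r) (p := 1 / r)
    (sum_enorm_rpow_ne_top (by positivity) b) (by positivity)
    (by push_cast; ring) (h1.trans ?_)
  calc _ ≤ C * ((‖a‖ₑ * (∑ i, ‖c i‖ₑ ^ r) ^ (1 / r)) * ∏ l, weakNorm 𝕜 r (x l)) := by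
        gcongr
        exact weakNorm_smul_const_le hr c a
    _ = _ := by
        simp only [hce, ← ENNReal.rpow_mul, one_div_mul_eq_div, enorm_eq_nnnorm, ENNReal.coe_mul]
        ring

/-- Freezing all variables but one. -/
theorem MultiDominatedBound.toContinuousLinearMap {E : Fin (k + 1) → Type u}
    [∀ i, NormedAddCommGroup (E i)] [∀ i, NormedSpace 𝕜 (E i)] (hr : 0 < r)
    {T : ContinuousMultilinearMap 𝕜 E F} {C : ℝ≥0} (h : MultiDominatedBound r T C)
    (a : ∀ i, E i) (j : Fin (k + 1)) :
    SummingBound r (T.toContinuousLinearMap a j) (C * ∏ l ∈ Finset.univ.erase j, ‖a l‖₊) := by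
  rw [summingBound_iff hr]
  intro m x
  set b : Fin m → F := fun i => T.toContinuousLinearMap a j (x i) with hb
  set c : Fin m → 𝕜 := fun i => ((‖b i‖ ^ (1 : ℝ) : ℝ) : 𝕜) with hc
  have hce : ∀ i, ‖c i‖ₑ = ‖b i‖ₑ := fun i =>
    (ofReal_rpow_enorm zero_le_one).trans (ENNReal.rpow_one _)
  -- Each of the `k` frozen slots receives `c i • a l` with `|c i| = ‖b i‖`, so `T` takes a value of
  -- norm `‖b i‖ ^ (k+1)`.
  set y : ∀ l, Fin m → E l := Function.update (fun l i => c i • a l) j x with hy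
  have hT : ∀ i, ‖T fun l => y l i‖ₑ ^ (r / (k + 1 : ℕ)) = ‖b i‖ₑ ^ r := by
    intro i
    have h2 : (fun l => y l i) = fun l =>
        (if l = j then 1 else c i) • Function.update a j (x i) l := by
      ext l
      rcases eq_or_ne l j with rfl | hl
      · simp [hy]
      · simp [hy, hl]
    have h3 : (∏ l, if l = j then 1 else c i) = c i ^ k := by
      simp [Fin.prod_univ_succAbove _ j, Fin.succAbove_ne]
    have h4 : T (Function.update a j (x i)) = b i := rfl
    rw [h2, T.map_smul_univ, h3, h4, enorm_smul, enorm_pow, hce, ← pow_succ,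
      ← ENNReal.rpow_natCast, ← ENNReal.rpow_mul]
    congr 1
    field_simp
  have h1 := h m y
  simp only [hT] at h1
  rw [← Finset.mul_prod_erase _ _ (Finset.mem_univ j)] at h1
  -- With `S = ∑ ‖b i‖ ^ r`, each frozen slot contributes `S^{1/r}`; cancelling `k` of them from
  -- `S^{(k+1)/r}` leaves `S^{1/r}`.
  refine le_of_rpow_le_mul_rpow (s := ((k + 1 : ℕ) : ℝ) / r) (p := (1 / r) * k)
    (sum_enorm_rpow_ne_top hr.le b) (by positivity)
    (by push_cast; ring) (h1.trans ?_)
  calc _ ≤ C * (weakNorm 𝕜 r x *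
        ∏ l ∈ Finset.univ.erase j, (‖a l‖ₑ * (∑ i, ‖b i‖ₑ ^ r) ^ (1 / r))) := by
        gcongr with l hl
        · simp [hy]
        · rw [hy, Function.update_of_ne (Finset.ne_of_mem_erase hl)]
          simpa only [hce] using weakNorm_smul_const_le hr c (a l)
    _ = _ := by
        rw [Finset.prod_mul_distrib, Finset.prod_const, Finset.card_erase_of_mem
          (Finset.mem_univ j), Finset.card_univ, Fintype.card_fin, Nat.add_sub_cancel,
          ENNReal.rpow_mul, ENNReal.rpow_natCast]
        push_cast
        simp only [enorm_eq_nnnorm]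
        ring

end Multi

/-! ## Dominated polynomials -/

section Poly

variable {𝕜 : Type w} [RCLike 𝕜] {r : ℝ} {n k : ℕ} {E F G H : Type u}
  [NormedAddCommGroup E] [NormedSpace 𝕜 E] [NormedAddCommGroup F] [NormedSpace 𝕜 F]
  [NormedAddCommGroup G] [NormedSpace 𝕜 G] [NormedAddCommGroup H] [NormedSpace 𝕜 H]

/-- The polarization formula. -/
theorem IsSymmetric.polarization {T : ContinuousMultilinearMap 𝕜 (fun _ : Fin n => E) F}
    (hT : IsSymmetric T) (x : Fin n → E) :
    ∑ t : Finset (Fin n), (-1 : ℤ) ^ t.card • T (fun _ => ∑ j ∈ tᶜ, x j) =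
      n.factorial • T x := by
  classical
  -- Multilinear expansion yields the maps `f` with values in `tᶜ`, that is, those with `t`
  -- contained in the complement of the image of `f`.
  have h1 : ∀ t : Finset (Fin n), (-1 : ℤ) ^ t.card • T (fun _ => ∑ j ∈ tᶜ, x j) =
      ∑ f : Fin n → Fin n,
        (if t ⊆ (Finset.univ.image f)ᶜ then (-1 : ℤ) ^ t.card else 0) • T fun i => x (f i) := by
    intro t
    rw [T.map_sum_finset (fun _ => x) (fun _ => tᶜ), Finset.smul_sum]
    simp only [ite_smul, zero_smul]
    rw [← Finset.sum_filter]
    refine Finset.sum_congr ?_ fun _ _ => rfl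
    ext f
    simp only [Fintype.mem_piFinset, Finset.mem_compl, Finset.mem_filter, Finset.mem_univ,
      true_and, Finset.subset_compl_comm (s := t)]
    simp [Finset.subset_iff]
  rw [Finset.sum_congr rfl fun t _ => h1 t, Finset.sum_comm]
  -- The alternating sum over the subsets of a set vanishes unless the set is empty, so only
  -- surjective `f` survive. These are the permutations, and by symmetry each contributes `T x`.
  have h2 : ∀ f : Fin n → Fin n,
      ∑ t : Finset (Fin n), (if t ⊆ (Finset.univ.image f)ᶜ then (-1 : ℤ) ^ t.card else 0) =
        if (Finset.univ.image f)ᶜ = ∅ then 1 else 0 := by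
    intro f
    rw [← Finset.sum_powerset_neg_one_pow_card, ← Finset.sum_filter]
    congr 1
    ext t
    simp
  simp only [← Finset.sum_smul, h2]
  have h3 : n.factorial • T x = ∑ _σ : Equiv.Perm (Fin n), T x := by
    simp [Fintype.card_perm]
  rw [h3]
  symm
  refine Finset.sum_of_injOn (fun σ : Equiv.Perm (Fin n) => (σ : Fin n → Fin n))
    (fun _ _ _ _ h => DFunLike.coe_injective h) (fun _ _ => Finset.mem_coe.2 (Finset.mem_univ _))
    (fun f _ hf => ?_) (fun σ _ => ?_)
  · rw [if_neg, zero_smul]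
    rintro h
    refine hf ⟨Equiv.ofBijective f (Finite.surjective_iff_bijective.1 ?_), by simp, rfl⟩
    intro j
    have hj : j ∉ (Finset.univ.image f)ᶜ := by simp [h]
    simpa using hj
  · rw [if_pos, one_smul, hT σ x]
    simp [Finset.image_univ_equiv]

/-- Polarization with the factor `n! ≥ 1` discarded; the signs disappear in the norm. -/
theorem IsSymmetric.enorm_le_sum {T : ContinuousMultilinearMap 𝕜 (fun _ : Fin n => E) F}
    (hT : IsSymmetric T) (x : Fin n → E) :
    ‖T x‖ₑ ≤ ∑ t : Finset (Fin n), ‖T fun _ => ∑ j ∈ tᶜ, x j‖ₑ := by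
  have hf : (1 : ℝ) ≤ n.factorial := by exact_mod_cast n.factorial_pos
  calc ‖T x‖ₑ ≤ ‖n.factorial • T x‖ₑ := by
        rw [enorm_le_iff_norm_le, ← Nat.cast_smul_eq_nsmul 𝕜, norm_smul, RCLike.norm_natCast]
        exact le_mul_of_one_le_left (norm_nonneg _) hf
    _ ≤ ∑ t : Finset (Fin n), ‖(-1 : ℤ) ^ t.card • T fun _ => ∑ j ∈ tᶜ, x j‖ₑ := by
        rw [← hT.polarization]
        exact enorm_sum_le _ _
    _ = _ := by
        refine Finset.sum_congr rfl fun t _ => ?_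
        rcases neg_one_pow_eq_or ℤ t.card with h | h <;> simp [h]

/-- Feed the same sequence to every variable. `T` may be any map with diagonal `P`, so estimates for
non-symmetric products apply as well. -/
theorem polyDominatedBound_of_multi {P : HomPoly 𝕜 n E F}
    {T : ContinuousMultilinearMap 𝕜 (fun _ : Fin n => E) F} (hPT : ∀ x, P.1 x = T fun _ => x)
    {C : ℝ≥0} (h : MultiDominatedBound r T C) : PolyDominatedBound r P C := by
  intro m x
  simpa [hPT] using h m fun _ => x

/-- The factor `2 ^ n` counts the subsets in the polarization formula. A sum of at most `n`
sequences of weak norm at most one has weak norm at most `n`, and degree `n` turns this into `n ^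
n`. -/
theorem PolyDominatedBound.sum_polar_le (hn : 1 ≤ n) (hnr : (n : ℝ) ≤ r) {P : HomPoly 𝕜 n E F}
    {C : ℝ≥0} (h : PolyDominatedBound r P C) {m : ℕ} (x : Fin n → Fin m → E)
    (hx : ∀ j, weakNorm 𝕜 r (x j) ≤ 1) :
    (∑ i, ‖polar P fun j => x j i‖ₑ ^ (r / n)) ^ ((n : ℝ) / r) ≤ 2 ^ n * n ^ n * C := by
  have hn1 : (1 : ℝ) ≤ n := by exact_mod_cast hn
  have hr : 1 ≤ r := hn1.trans hnr
  have hp : 1 ≤ r / n := (one_le_div (by positivity)).2 hnr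
  calc _ ≤ (∑ i, (∑ t : Finset (Fin n), ‖P.1 (∑ j ∈ tᶜ, x j i)‖ₑ) ^ (r / n)) ^
          ((n : ℝ) / r) := by
        gcongr with i
        simpa only [polar_diag] using (polar_isSymmetric P).enorm_le_sum fun j => x j i
    _ ≤ ∑ t : Finset (Fin n), (∑ i, ‖P.1 (∑ j ∈ tᶜ, x j i)‖ₑ ^ (r / n)) ^ ((n : ℝ) / r) := by
        simpa only [one_div_div] using sum_finset_sum_le Finset.univ
          (fun (t : Finset (Fin n)) i => ‖P.1 (∑ j ∈ tᶜ, x j i)‖ₑ) hp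
    _ ≤ ∑ _t : Finset (Fin n), (C : ℝ≥0∞) * (n : ℝ≥0∞) ^ n := by
        refine Finset.sum_le_sum fun t _ => (h m fun i => ∑ j ∈ tᶜ, x j i).trans ?_
        gcongr
        calc _ ≤ ∑ j ∈ tᶜ, weakNorm 𝕜 r (x j) := weakNorm_sum_le hr _ _
          _ ≤ ∑ j, weakNorm 𝕜 r (x j) :=
            Finset.sum_le_sum_of_subset (Finset.subset_univ _)
          _ ≤ ∑ _j : Fin n, 1 := Finset.sum_le_sum fun j _ => hx j
          _ = n := by simp
    _ = _ := by
        simp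
        ring

theorem PolyDominatedBound.polar (hn : 1 ≤ n) (hnr : (n : ℝ) ≤ r) {P : HomPoly 𝕜 n E F}
    {C : ℝ≥0} (h : PolyDominatedBound r P C) :
    MultiDominatedBound r (polar P) (2 ^ n * n ^ n * C) := by
  have hr : 0 < r := lt_of_lt_of_le (by positivity) hnr
  have hn0 : (0 : ℝ) < n := by positivity
  intro m x
  -- A sequence of weak norm zero cannot be normalised, but it is identically zero and so is the
  -- left side.
  by_cases h0 : ∃ j, weakNorm 𝕜 r (x j) = 0
  · obtain ⟨j, hj⟩ := h0
    have : ∀ i, DominatedIdeals.polar P (fun j => x j i) = 0 := fun i =>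
      (DominatedIdeals.polar P).map_coord_zero j (eq_zero_of_weakNorm_eq_zero hr hj i)
    simp only [this, enorm_zero]
    rw [ENNReal.zero_rpow_of_pos (by positivity), Finset.sum_const_zero,
      ENNReal.zero_rpow_of_pos (by positivity)]
    exact bot_le
  push Not at h0
  have hW : ∀ j, ((weakNorm 𝕜 r (x j)).toNNReal : ℝ≥0∞) = weakNorm 𝕜 r (x j) := fun j =>
    ENNReal.coe_toNNReal (weakNorm_ne_top hr _)
  set c : Fin n → ℝ≥0 := fun j => (weakNorm 𝕜 r (x j)).toNNReal with hc
  have hc0 : ∀ j, c j ≠ 0 := fun j hj => h0 j (by rw [← hW j]; exact_mod_cast hj)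
  have hcK : ∀ j, (((c j : ℝ)) : 𝕜) ≠ 0 := fun j => by exact_mod_cast hc0 j
  have hce : ∀ j, ‖(((c j : ℝ)) : 𝕜)‖ₑ = c j := fun j => by
    rw [enorm_eq_nnnorm]
    congr 1
    ext
    simp
  -- Each sequence is divided by its own weak norm; multilinearity then restores the product of the
  -- weak norms.
  have h1 := h.sum_polar_le hn hnr (fun j i => (((c j : ℝ)) : 𝕜)⁻¹ • x j i) fun j => by
    refine (weakNorm_const_smul_le hr _ _).trans ?_
    rw [enorm_inv (hcK j), hce, ← hW j]
    exact ENNReal.inv_mul_le_one _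
  have h2 : ∀ i, ‖DominatedIdeals.polar P fun j => x j i‖ₑ =
      (∏ j, (c j : ℝ≥0∞)) *
        ‖DominatedIdeals.polar P fun j => (((c j : ℝ)) : 𝕜)⁻¹ • x j i‖ₑ := by
    intro i
    have h3 := (DominatedIdeals.polar P).map_smul_univ (fun j => (((c j : ℝ)) : 𝕜))
      fun j => (((c j : ℝ)) : 𝕜)⁻¹ • x j i
    simp only [smul_inv_smul₀ (hcK _)] at h3
    rw [h3, enorm_smul]
    congr 1
    simp only [← hce, enorm_eq_nnnorm, nnnorm_prod, ENNReal.ofNNReal_finsetProd]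
  simp only [h2]
  have hWc : ∏ j, weakNorm 𝕜 r (x j) = ∏ j, (c j : ℝ≥0∞) :=
    Finset.prod_congr rfl fun j _ => (hW j).symm
  rw [sum_rpow_mul_left hn hr, mul_comm, hWc]
  push_cast
  gcongr

theorem PolyDominatedBound.comp (hn : 1 ≤ n) (hr : 0 < r) {P : HomPoly 𝕜 n E F} {C : ℝ≥0}
    (h : PolyDominatedBound r P C) (w : F →L[𝕜] H) (t : G →L[𝕜] E) :
    PolyDominatedBound r (polyComp w P t) (‖w‖₊ * C * ‖t‖₊ ^ n) := by
  intro m x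
  calc _ ≤ (∑ i, (‖w‖ₑ * ‖P.1 (t (x i))‖ₑ) ^ (r / n)) ^ ((n : ℝ) / r) := by
        gcongr with i
        exact w.le_opENorm _
    _ ≤ ‖w‖ₑ * (C * (‖t‖ₑ * weakNorm 𝕜 r x) ^ n) := by
        rw [sum_rpow_mul_left hn hr]
        gcongr
        refine (h m fun i => t (x i)).trans ?_
        gcongr
        exact weakNorm_comp_le hr _ _
    _ = _ := by
        push_cast
        simp only [enorm_eq_nnnorm]
        ring

theorem PolyDominatedBound.functionalMul (hk : 1 ≤ k) (hr : 0 < r) (γ : E →L[𝕜] 𝕜)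
    {P : HomPoly 𝕜 k E F} {C : ℝ≥0} (h : PolyDominatedBound r P C) :
    PolyDominatedBound r (functionalMulPoly γ P) (‖γ‖₊ * C) := by
  intro m x
  calc _ = (∑ i, (‖P.1 (x i)‖ₑ * ‖γ (x i)‖ₑ) ^ (r / (k + 1 : ℕ))) ^
        (((k + 1 : ℕ) : ℝ) / r) := by
        simp only [functionalMulPoly, enorm_smul, mul_comm]
    _ ≤ (C * weakNorm 𝕜 r x ^ k) * (‖γ‖ₑ * weakNorm 𝕜 r x) :=
        (sum_mul_le_mul_sum hk hr _ _).trans (mul_le_mul' (h m x) (sum_le_weakNorm hr _ _))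
    _ = _ := by
        push_cast
        simp only [enorm_eq_nnnorm]
        ring

/-! ## Degree one -/

theorem summingBound_iff_poly (hr : 0 < r) {v : E →L[𝕜] F} {P : HomPoly 𝕜 1 E F}
    (hP : ∀ x, P.1 x = v x) (C : ℝ≥0) : SummingBound r v C ↔ PolyDominatedBound r P C := by
  rw [summingBound_iff hr]
  refine forall₂_congr fun m x => ?_
  simp [hP]

theorem summingBound_iff_multi {E : Fin 1 → Type u} [∀ i, NormedAddCommGroup (E i)]
    [∀ i, NormedSpace 𝕜 (E i)] (hr : 0 < r) {v : E 0 →L[𝕜] F} {T : ContinuousMultilinearMap 𝕜 E F}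
    (hT : ∀ x, T x = v (x 0)) (C : ℝ≥0) : SummingBound r v C ↔ MultiDominatedBound r T C := by
  rw [summingBound_iff hr]
  refine forall_congr' fun m => ⟨fun h x => by simpa [hT] using h (x 0), fun h x => ?_⟩
  simpa [hT] using h (Fin.cons (α := fun j => Fin m → E j) x finZeroElim)

end Poly

/-! ## The ideal properties -/

section Ideals

variable (𝕜 : Type w) [RCLike 𝕜] {r : ℝ} {n : ℕ}

theorem one_le_of_enorm_le_mul {F : Type u} [NormedAddCommGroup F] {a : F} (ha : ‖a‖ = 1)
    {C : ℝ≥0} {D : ℝ≥0∞} (hD : D ≤ 1) (h : ‖a‖ₑ ≤ C * D) : 1 ≤ C := by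
  have h1 : (1 : ℝ≥0∞) ≤ C * 1 := by
    calc (1 : ℝ≥0∞) = ‖a‖ₑ := by rw [← enorm_norm, ha, enorm_one]
      _ ≤ C * D := h
      _ ≤ _ := by gcongr
  simpa using h1

theorem LinearIsometryEquiv.nnnorm_toContinuousLinearMap_le {L M : Type*} [NormedAddCommGroup L]
    [NormedSpace 𝕜 L] [NormedAddCommGroup M] [NormedSpace 𝕜 M] (e : L ≃ₗᵢ[𝕜] M) :
    ‖e.toLinearIsometry.toContinuousLinearMap‖₊ ≤ 1 :=
  e.toLinearIsometry.norm_toContinuousLinearMap_le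

theorem weakNorm_symm_one_le {L : Type u} [NormedAddCommGroup L] [NormedSpace 𝕜 L]
    (hr : 0 < r) (e : L ≃ₗᵢ[𝕜] 𝕜) : weakNorm 𝕜 r (fun _ : Fin 1 => e.symm 1) ≤ 1 := by
  refine (weakNorm_single_le hr _).trans_eq ?_
  rw [← enorm_norm]
  simp

theorem dominatedMulti_isQuasiNormedMultiIdeal (hn : 1 ≤ n) (hnr : (n : ℝ) ≤ r) :
    IsQuasiNormedMultiIdeal n (dominatedMulti.{u, w} 𝕜 r) where
  quasiNormed E F := by
    intros
    exact ⟨1, multi_isQuasiNormedSubspace hn hnr E F⟩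
  finiteType {E F} _ _ _ _ _ _ T hT := by
    have hr : 0 < r := lt_of_lt_of_le (by positivity) hnr
    have hq := multi_isQuasiNormedSubspace (𝕜 := 𝕜) hn hnr E F
    refine Submodule.span_induction (p := fun T _ => ∃ C, MultiDominatedBound r T C)
      ?_ hq.zero_mem (fun _ _ _ _ => hq.add_mem _ _) (fun c _ _ => hq.smul_mem c _) hT
    rintro S ⟨γ, b, hS⟩
    refine ⟨_, multiDominatedBound_of_le_prod hn hr γ ‖b‖₊ fun x => le_of_eq ?_⟩
    rw [hS, enorm_smul, mul_comm]
    simp only [enorm_eq_nnnorm, nnnorm_prod, ENNReal.ofNNReal_finsetProd]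
  normalised {L} _ _ _ e T hT := by
    have hr : 0 < r := lt_of_lt_of_le (by positivity) hnr
    refine sInf_eq_one_of_bound ?_ fun C hC => ?_
    -- Upper bound: `‖T x‖` is the product of the `|e (x i)|`, and `e` has norm at most one. The
    -- lower bound tests the single vector `e.symm 1`.
    · have h1 := multiDominatedBound_of_le_prod hn hr (T := T)
        (fun _ => e.toLinearIsometry.toContinuousLinearMap) 1 fun x => by
          rw [hT, ← enorm_norm, LinearIsometryEquiv.norm_map, enorm_norm]
          simp [enorm_eq_nnnorm, nnnorm_prod]
      intro m x
      refine (h1 m x).trans ?_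
      gcongr
      rw [one_mul]
      exact Finset.prod_le_one' fun _ _ => LinearIsometryEquiv.nnnorm_toContinuousLinearMap_le 𝕜 e
    · have h1 := hC 1 fun _ _ => e.symm 1
      rw [sum_single_rpow hn hr] at h1
      refine one_le_of_enorm_le_mul ?_ ?_ h1
      · rw [hT, LinearIsometryEquiv.norm_map]
        simp
      · exact Finset.prod_le_one' fun _ _ => weakNorm_symm_one_le 𝕜 hr e
  comp {E G F H} _ _ _ _ _ _ _ _ _ _ _ _ w T t hT := by
    have hr : 0 < r := lt_of_lt_of_le (by positivity) hnr
    exact exists_and_sInf_le ((MultiDominatedBound.sInf hr hT).comp hn hr w t)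
      (by simp only [NNReal.coe_mul, NNReal.coe_prod, coe_nnnorm]; exact le_rfl)

theorem dominatedPoly_isQuasiNormedPolyIdeal (hn : 1 ≤ n) (hnr : (n : ℝ) ≤ r) :
    IsQuasiNormedPolyIdeal n (dominatedPoly.{u, w} 𝕜 r) where
  quasiNormed E F := by
    intros
    exact ⟨1, poly_isQuasiNormedSubspace hn hnr E F⟩
  finiteType {E F} _ _ _ _ _ _ P hP := by
    have hr : 0 < r := lt_of_lt_of_le (by positivity) hnr
    have hq := poly_isQuasiNormedSubspace (𝕜 := 𝕜) hn hnr E F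
    refine Submodule.span_induction (p := fun P _ => ∃ C, PolyDominatedBound r P C)
      ?_ hq.zero_mem (fun _ _ _ _ => hq.add_mem _ _) (fun c _ _ => hq.smul_mem c _) hP
    rintro R ⟨γ, b, hR⟩
    refine ⟨_, polyDominatedBound_of_multi
      (T := ((ContinuousMultilinearMap.mkPiAlgebra 𝕜 (Fin n) 𝕜).compContinuousLinearMap
        fun _ => γ).smulRight b) (fun x => by simp [hR])
      (multiDominatedBound_of_le_prod hn hr (fun _ => γ) ‖b‖₊ fun x => le_of_eq ?_)⟩
    exact (enorm_smul (∏ i, γ (x i)) b).trans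
      (by simp [enorm_eq_nnnorm, nnnorm_prod, mul_comm])
  normalised {L} _ _ _ e P hP := by
    have hr : 0 < r := lt_of_lt_of_le (by positivity) hnr
    refine sInf_eq_one_of_bound ?_ fun C hC => ?_
    · have h1 := multiDominatedBound_of_le_prod hn hr
        (T := (e.symm.toLinearIsometry.toContinuousLinearMap).compContinuousMultilinearMap
          ((ContinuousMultilinearMap.mkPiAlgebra 𝕜 (Fin n) 𝕜).compContinuousLinearMap
            fun _ => e.toLinearIsometry.toContinuousLinearMap))
        (fun _ => e.toLinearIsometry.toContinuousLinearMap) 1 fun x => le_of_eq (by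
          rw [← enorm_norm]
          simp [enorm_eq_nnnorm, nnnorm_prod])
      intro m x
      refine (polyDominatedBound_of_multi (P := P) (fun x => by simp [hP]) h1 m x).trans ?_
      gcongr
      rw [one_mul]
      exact Finset.prod_le_one' fun _ _ => LinearIsometryEquiv.nnnorm_toContinuousLinearMap_le 𝕜 e
    · have h1 := hC 1 fun _ => e.symm 1
      rw [sum_single_rpow hn hr] at h1
      refine one_le_of_enorm_le_mul ?_ ?_ h1
      · rw [hP, LinearIsometryEquiv.norm_map]
        simp
      · exact pow_le_one' (weakNorm_symm_one_le 𝕜 hr e) n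
  comp {E F G H} _ _ _ _ _ _ _ _ _ _ _ _ w P t hP := by
    have hr : 0 < r := lt_of_lt_of_le (by positivity) hnr
    exact exists_and_sInf_le ((PolyDominatedBound.sInf hr hP).comp hn hr w t)
      (by simp only [NNReal.coe_mul, NNReal.coe_pow, coe_nnnorm]; exact le_rfl)

variable {𝕜}

/-! ### The operator ideal, through degree one -/

theorem summingBound_smulRight {E F : Type u} [NormedAddCommGroup E] [NormedSpace 𝕜 E]
    [NormedAddCommGroup F] [NormedSpace 𝕜 F] (hr : 0 < r) (φ : E →L[𝕜] 𝕜) (b : F) :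
    SummingBound r (φ.smulRight b) (‖b‖₊ * ‖φ‖₊) := by
  have h := multiDominatedBound_of_le_prod (E := fun _ : Fin 1 => E) le_rfl hr
    (T := ContinuousMultilinearMap.ofSubsingleton 𝕜 E F 0 (φ.smulRight b)) (fun _ => φ) ‖b‖₊
    fun x => le_of_eq (by
      rw [Fin.prod_univ_one]
      exact (enorm_smul _ _).trans (mul_comm _ _))
  rw [Fin.prod_univ_one] at h
  exact (summingBound_iff_multi hr (fun x => by simp) _).2 h

theorem exists_summingBound_of_finiteDimensional_range {E F : Type u} [NormedAddCommGroup E]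
    [NormedSpace 𝕜 E] [NormedAddCommGroup F] [NormedSpace 𝕜 F] (hr : 1 ≤ r) (v : E →L[𝕜] F)
    (hv : FiniteDimensional 𝕜 (LinearMap.range (v : E →ₗ[𝕜] F))) : ∃ C, SummingBound r v C := by
  have hq := summing_isQuasiNormedSubspace (𝕜 := 𝕜) hr E F
  set R := LinearMap.range (v : E →ₗ[𝕜] F)
  set b := Module.finBasis 𝕜 R
  set v' : E →L[𝕜] R := v.codRestrict R fun x => ⟨x, rfl⟩
  -- A basis of the range splits `v` into rank-one operators; the coordinates are continuous because
  -- the range is finite-dimensional.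
  have hsum : v = ∑ i, ((LinearMap.toContinuousLinearMap (b.coord i)) ∘L v').smulRight
      (b i : F) := by
    ext x
    have h := congrArg (Submodule.subtype R) (b.sum_repr (v' x))
    rw [map_sum] at h
    exact h.symm.trans (by simp)
  rw [hsum]
  exact Finset.sum_induction _ (fun v : E →L[𝕜] F => ∃ C, SummingBound r v C)
    (fun _ _ => hq.add_mem _ _) hq.zero_mem
    fun i _ => ⟨_, summingBound_smulRight (by linarith) _ _⟩

theorem SummingBound.comp {E F G H : Type u} [NormedAddCommGroup E] [NormedSpace 𝕜 E]
    [NormedAddCommGroup F] [NormedSpace 𝕜 F] [NormedAddCommGroup G] [NormedSpace 𝕜 G]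
    [NormedAddCommGroup H] [NormedSpace 𝕜 H] (hr : 0 < r) {v : E →L[𝕜] F} {C : ℝ≥0}
    (h : SummingBound r v C) (w : F →L[𝕜] H) (t : G →L[𝕜] E) :
    SummingBound r (w ∘L v ∘L t) (‖w‖₊ * C * ‖t‖₊) := by
  have h1 := ((summingBound_iff_multi (E := fun _ : Fin 1 => E) hr
    (T := ContinuousMultilinearMap.ofSubsingleton 𝕜 E F 0 v) (fun x => by simp) C).1 h).comp
    le_rfl hr w fun _ => t
  rw [Fin.prod_univ_one] at h1
  exact (summingBound_iff_multi hr (fun x => by simp) _).2 h1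

variable (𝕜)

theorem summingIdeal_isNormedOperatorIdeal (hr : 1 ≤ r) :
    IsNormedOperatorIdeal (summingIdeal.{u, w} 𝕜 r) where
  normed E F := by
    intros
    exact summing_isQuasiNormedSubspace hr E F
  finiteRank v hv := exists_summingBound_of_finiteDimensional_range hr v hv
  normalised {L} _ _ _ e := by
    have hr0 : 0 < r := by linarith
    have h1 := (dominatedMulti_isQuasiNormedMultiIdeal.{u, w} (n := 1) 𝕜 le_rfl
      (by simpa using hr)).normalised e
      (ContinuousMultilinearMap.ofSubsingleton 𝕜 L L 0 (ContinuousLinearMap.id 𝕜 L))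
      fun x => by simp
    refine Eq.trans ?_ h1
    simp only [summingIdeal, dominatedMulti]
    congr 2
    ext C
    exact summingBound_iff_multi (E := fun _ : Fin 1 => L) hr0 (fun x => by simp) C
  comp {E F G H} _ _ _ _ _ _ _ _ _ _ _ _ w v t hv := by
    have hr0 : 0 < r := by linarith
    exact exists_and_sInf_le ((SummingBound.sInf hr0 hv).comp hr0 w t)
      (by simp only [NNReal.coe_mul, coe_nnnorm]; exact le_rfl)

theorem natCast_le_of_le_floor {k : ℕ} (hr : 0 ≤ r) (h : (k : ℕ∞) ≤ (⌊r⌋₊ : ℕ∞)) :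
    (k : ℝ) ≤ r :=
  (Nat.le_floor_iff hr).1 (by exact_mod_cast h)

theorem isPairSequence_dominated (hr : 1 ≤ r) :
    IsPairSequence (⌊r⌋₊ : ℕ∞) (summingIdeal.{u, w} 𝕜 r) (dominatedPoly 𝕜 r)
      (dominatedMulti 𝕜 r) where
  operatorIdeal := summingIdeal_isNormedOperatorIdeal 𝕜 hr
  polyIdeal k hk hkr :=
    dominatedPoly_isQuasiNormedPolyIdeal 𝕜 hk (natCast_le_of_le_floor (by linarith) hkr)
  multiIdeal k hk hkr :=
    dominatedMulti_isQuasiNormedMultiIdeal 𝕜 hk (natCast_le_of_le_floor (by linarith) hkr)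
  poly_one {E F} _ _ _ _ _ _ v P h := by
    have hiff := fun C => summingBound_iff_poly (by linarith) h C
    simp [summingIdeal, dominatedPoly, hiff]
  multi_one {E F} _ _ _ _ _ _ v T h := by
    have hiff := fun C => summingBound_iff_multi (by linarith) h C
    simp [summingIdeal, dominatedMulti, hiff]

/-! ## Compatibility and coherence -/

theorem dominatedPoly_mem_iff_polar (hn : 1 ≤ n) (hnr : (n : ℝ) ≤ r) {E F : Type u}
    [NormedAddCommGroup E] [NormedSpace 𝕜 E] [CompleteSpace E]
    [NormedAddCommGroup F] [NormedSpace 𝕜 F] [CompleteSpace F] (P : HomPoly 𝕜 n E F) :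
    (dominatedPoly 𝕜 r).mem P ↔ (dominatedMulti 𝕜 r).mem (polar P) :=
  ⟨fun ⟨_, h⟩ => ⟨_, h.polar hn hnr⟩,
    fun ⟨_, h⟩ => ⟨_, polyDominatedBound_of_multi (polar_diag P) h⟩⟩

/-- Replaces the polarization constant of each degree by that of the top degree, making it uniform.
-/
theorem two_pow_mul_pow_self_le {m N : ℕ} (hN : 1 ≤ N) (h : m ≤ N) :
    (2 : ℝ) ^ m * (m : ℝ) ^ m ≤ 2 ^ N * (N : ℝ) ^ N := by
  have : 2 ^ m * m ^ m ≤ 2 ^ N * N ^ N :=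
    Nat.mul_le_mul (Nat.pow_le_pow_right two_pos h)
      ((Nat.pow_le_pow_left h m).trans (Nat.pow_le_pow_right hN h))
  exact_mod_cast this

theorem stronglyCoherent_dominated (hr : 1 ≤ r) :
    StronglyCoherent (⌊r⌋₊ : ℕ∞) (summingIdeal.{u, w} 𝕜 r) (dominatedPoly 𝕜 r)
      (dominatedMulti 𝕜 r) := by
  have hr0 : 0 < r := by linarith
  have hN : 1 ≤ ⌊r⌋₊ := (Nat.le_floor_iff hr0.le).2 (by simpa using hr)
  -- Only (CH2*) passes through polarization; the other constants are one.
  refine ⟨isPairSequence_dominated 𝕜 hr, ⟨1, 2 ^ ⌊r⌋₊ * (⌊r⌋₊ : ℝ) ^ ⌊r⌋₊, 1, 1, one_pos,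
    by positivity, one_pos, one_pos, fun k hk hkN => ⟨?_, ?_, ?_, ?_⟩⟩, ?_⟩
  · intro E F _ _ _ _ _ _ T j a hT
    exact exists_and_sInf_le ((MultiDominatedBound.sInf hr0 hT).curryMid hk hr0 j a)
      (by simp [dominatedMulti])
  · intro E F _ _ _ _ _ _ P a hP
    -- `P_a` is the diagonal of `P^∨` with its first variable frozen at `a`.
    have h1 := (((PolyDominatedBound.sInf hr0 hP).polar (by simp)
      (natCast_le_of_le_floor hr0.le hkN)).curryMid hk hr0 0 a)
    refine exists_and_sInf_le (polyDominatedBound_of_multi (P := polyAt P a) (fun x => ?_) h1) ?_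
    · rw [ContinuousMultilinearMap.curryMid_apply, polyAt, Fin.insertNth_zero]
      rfl
    · have := two_pow_mul_pow_self_le hN (by exact_mod_cast hkN : k + 1 ≤ ⌊r⌋₊)
      simp only [dominatedPoly, NNReal.coe_mul, NNReal.coe_pow, NNReal.coe_ofNat,
        NNReal.coe_natCast, coe_nnnorm]
      gcongr
  · intro E F _ _ _ _ _ _ γ T hT
    exact exists_and_sInf_le ((MultiDominatedBound.sInf hr0 hT).functionalMul hk hr0 γ)
      (by simp [dominatedMulti])
  · intro E F _ _ _ _ _ _ γ P hP
    exact exists_and_sInf_le ((PolyDominatedBound.sInf hr0 hP).functionalMul hk hr0 γ)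
      (by simp [dominatedPoly])
  · intro k hk hkN E F _ _ _ _ _ _ P
    exact dominatedPoly_mem_iff_polar 𝕜 hk (natCast_le_of_le_floor hr0.le hkN) P

theorem stronglyCompatible_dominated (hr : 1 ≤ r) :
    StronglyCompatible (⌊r⌋₊ : ℕ∞) (summingIdeal.{u, w} 𝕜 r) (dominatedPoly 𝕜 r)
      (dominatedMulti 𝕜 r) := by
  have hr0 : 0 < r := by linarith
  have hN : 1 ≤ ⌊r⌋₊ := (Nat.le_floor_iff hr0.le).2 (by simpa using hr)
  refine ⟨isPairSequence_dominated 𝕜 hr, 1, 2 ^ ⌊r⌋₊ * (⌊r⌋₊ : ℝ) ^ ⌊r⌋₊, 1, 1, one_pos,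
    by positivity, one_pos, one_pos, fun m hm hmN => ⟨?_, ?_, ?_, ?_, ?_⟩⟩
  · intro E F _ _ _ _ _ _ k T a hT
    exact exists_and_sInf_le ((MultiDominatedBound.sInf hr0 hT).toContinuousLinearMap hr0 a k)
      (by simp [dominatedMulti])
  · intro E F _ _ _ _ _ _ P a hP
    refine exists_and_sInf_le (((PolyDominatedBound.sInf hr0 hP).polar (by simp)
      (natCast_le_of_le_floor hr0.le hmN)).toContinuousLinearMap hr0 (fun _ => a) (Fin.last m)) ?_
    have := two_pow_mul_pow_self_le hN (by exact_mod_cast hmN : m + 1 ≤ ⌊r⌋₊)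
    rw [Finset.prod_const, Finset.card_erase_of_mem (Finset.mem_univ _), Finset.card_univ,
      Fintype.card_fin, Nat.add_sub_cancel]
    simp only [dominatedPoly, NNReal.coe_mul, NNReal.coe_pow, NNReal.coe_ofNat,
      NNReal.coe_natCast, coe_nnnorm]
    gcongr
  · intro E F _ _ _ _ _ _ γ v hv
    exact exists_and_sInf_le (multiDominatedBound_functionalsMulLinear hr0 γ
      (SummingBound.sInf hr0 hv)) (by simp [summingIdeal])
  · intro E F _ _ _ _ _ _ γ v hv
    -- (CP4) is the diagonal of (CP3) with all functionals equal to `γ`.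
    have h1 := multiDominatedBound_functionalsMulLinear (E := fun _ : Fin (m + 1) => E) hr0
      (fun _ => γ) (SummingBound.sInf hr0 hv)
    refine exists_and_sInf_le
      (polyDominatedBound_of_multi (P := functionalPowMulLinear m γ v) (fun x => ?_) h1) ?_
    · rw [functionalsMulLinear_apply, Finset.prod_const, Finset.card_univ, Fintype.card_fin]
      rfl
    · simp [summingIdeal]
  · intro E F _ _ _ _ _ _ P
    exact dominatedPoly_mem_iff_polar 𝕜 (by simp) (natCast_le_of_le_floor hr0.le hmN) P

end Ideals
end DominatedIdeals

theorem mainTheorem5 (𝕜 : Type w) [RCLike 𝕜] (r : ℝ) (hr : 1 ≤ r) :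
    DominatedIdeals.StronglyCoherent.{u, w} (⌊r⌋₊ : ℕ∞)
      (DominatedIdeals.summingIdeal 𝕜 r) (DominatedIdeals.dominatedPoly 𝕜 r)
      (DominatedIdeals.dominatedMulti 𝕜 r) ∧
    DominatedIdeals.StronglyCompatible.{u, w} (⌊r⌋₊ : ℕ∞)
      (DominatedIdeals.summingIdeal 𝕜 r) (DominatedIdeals.dominatedPoly 𝕜 r)
      (DominatedIdeals.dominatedMulti 𝕜 r) :=
  ⟨DominatedIdeals.stronglyCoherent_dominated 𝕜 hr,
    DominatedIdeals.stronglyCompatible_dominated 𝕜 hr⟩
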